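/- Let $\lambda_1,\lambda_2,\lambda_3$ be pairwise distinct real numbers. Everything is $C^\infty$. A *Veronese web* on a 3-dimensional manifold $M$ is a family $\{\mathcal F_\lambda\}_{\lambda\in\mathbb R\cup\{\infty\}}$ of foliations of rank 2 such that near every point there is a coframe $\alpha_0,\alpha_1,\alpha_2$ with $T\mathcal F_\lambda=\ker(\alpha_0+\lambda\alpha_1+\lambda^2\alpha_2)$ for $\lambda\in\mathbb R$ and $T\mathcal F_\infty=\ker\alpha_2$. A *first integral* of a rank 2 foliation $\mathcal F$ is a smooth function $f$ with $df\neq0$ and $T\mathcal F=\ker df$; we then write $\mathcal F=\{f=\mathrm{const}\}$. Consider the dispersionless Hirota equation $$(\lambda_2-\lambda_3)f_{x_1}f_{x_2x_3}+(\lambda_3-\lambda_1)f_{x_2}f_{x_3x_1}+(\lambda_1-\lambda_2)f_{x_3}f_{x_1x_2}=0 .\qquad(\mathrm H)$$ 1. Let $f$ be a solution of (H) on an open set $U\subset\mathbb R^3$ with $f_{x_i}\ne0$ everywhere, $i=1,2,3$. Then the 1-form $$\alpha^\lambda=(\lambda_2-\lambda)(\lambda_3-\lambda)f_{x_1}dx_1+(\lambda_3-\lambda)(\lambda_1-\lambda)f_{x_2}dx_2+(\lambda_1-\lambda)(\lambda_2-\lambda)f_{x_3}dx_3$$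 (with $\alpha^\infty$ the coefficient of $\lambda^2$) defines a Veronese web on $U$ by $T\mathcal F_\lambda=\ker\alpha^\lambda$, and $$\mathcal F_{\lambda_i}=\{x_i=\mathrm{const}\}\ (i=1,2,3),\qquad \mathcal F_\infty=\{f=\mathrm{const}\}.\qquad(\mathrm F)$$ 2. Conversely, let $\{\mathcal F_\lambda\}$ be a Veronese web on a smooth 3-dimensional manifold $M$. Then in a neighbourhood of any point of $M$ there exist local coordinates $(x_1,x_2,x_3)$ with $\mathcal F_{\lambda_i}=\{x_i=\mathrm{const}\}$, $i=1,2,3$, such that every first integral $f$ of $\mathcal F_\infty$ on an open subset of the coordinate domain is, in these coordinates, a solution of (H) with $f_{x_i}\neq0$, and there $T\mathcal F_\lambda=\ker\alpha^\lambda$ for all $\lambda\in\mathbb R\cup\{\infty\}$. 3. For functions $f$ near $p\in\mathbb R^3$ and $g$ near $q\in\mathbb R^3$ write $f\sim g$ if there are local diffeomorphisms $\psi,\phi_1,\phi_2,\phi_3$ of $\mathbb R$ with $\phi_i(p_i)=q_i$ and $f(x_1,x_2,x_3)=\psi(g(\phi_1(x_1),\phi_2(x_2),\phi_3(x_3)))$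 near $p$. If $f\sim g$, $g$ is smooth near $q$, and $f$ solves (H) near $p$ with $f_{x_i}\ne0$, then $g$ solves (H) near $q$ with $g_{x_i}\neq0$. Moreover $\sim$ is an equivalence relation on the pairs (solution $f$ of (H) with $f_{x_i}\ne0$ on an open set, point $p$ of that set), and there is a one-to-one correspondence between the equivalence classes $[f]$ of such solutions and the Veronese webs on open sets of 3-dimensional manifolds with a marked point, taken up to local diffeomorphisms which preserve the marked points and identify $\mathcal F_\lambda$ with $\mathcal F'_\lambda$ for all $\lambda$ near these points. Under it, $[f]$ corresponds to the class of $\{\mathcal F_\lambda\}$ if and only if near the marked point of the web there are local coordinates $(x_1,x_2,x_3)$, with value $p$ at the marked point, in which (F) holds. -/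

import Mathlib

open scoped Manifold ContDiff Topology

noncomputable section

/-- The space `ℝ³` with coordinates `(x 0, x 1, x 2)`. -/
abbrev R3 : Type := EuclideanSpace ℝ (Fin 3)

/-! ### Foliations of rank two and Veronese webs on three-dimensional manifolds

A foliation of rank two is represented by its tangent distribution, a plane field which is locally
the kernel field of the differential of a submersion to `ℝ`; the leaves are locally the level sets
of that submersion. -/

section Webs

variable {M : Type*} [TopologicalSpace M] [ChartedSpace R3 M]

/-- A field of subspaces of the tangent spaces of `M`. -/
abbrev TangentField (M : Type*) [TopologicalSpace M] [ChartedSpace R3 M] : Type _ :=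
  (x : M) → Submodule ℝ (TangentSpace (𝓡 3) x)

/-- A one-form on `M` (not necessarily smooth). -/
abbrev OneForm (M : Type*) [TopologicalSpace M] [ChartedSpace R3 M] : Type _ :=
  (x : M) → (TangentSpace (𝓡 3) x →L[ℝ] ℝ)

/-- The one-form `α` is a smooth section of the cotangent bundle over `V`. -/
def OneForm.SmoothOn [IsManifold (𝓡 3) ∞ M] (α : OneForm M) (V : Set M) : Prop :=
  ContMDiffOn (𝓡 3) ((𝓡 3).prod 𝓘(ℝ, R3 →L[ℝ] ℝ)) ∞
    (fun x => Bundle.TotalSpace.mk' (R3 →L[ℝ] ℝ)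
      (E := fun y : M => (TangentSpace (𝓡 3) y →L[ℝ] Bundle.Trivial M ℝ y)) x (α x)) V

/-- The smooth function `g` is a first integral on `V` of the rank two foliation with tangent
distribution `D`: it is a submersion on `V` and `D = ker dg` there.  In other words, on `V` the
foliation is `{g = const}`. -/
def IsFirstIntegralOn (D : TangentField M) (g : M → ℝ) (V : Set M) : Prop :=
  ContMDiffOn (𝓡 3) 𝓘(ℝ, ℝ) ∞ g V ∧
    ∀ x ∈ V, mfderiv (𝓡 3) 𝓘(ℝ, ℝ) g x ≠ 0 ∧
      D x = LinearMap.ker (mfderiv (𝓡 3) 𝓘(ℝ, ℝ) g x).toLinearMap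

/-- `D` is, over the open set `U`, the tangent distribution of a smooth foliation of rank two:
every point of `U` has a neighbourhood with a submersive first integral. -/
def IsFoliationOn (D : TangentField M) (U : Set M) : Prop :=
  ∀ p ∈ U, ∃ V : Set M, IsOpen V ∧ p ∈ V ∧ V ⊆ U ∧ ∃ g : M → ℝ, IsFirstIntegralOn D g V

/-- The curve `s ↦ α₀ + s α₁ + s² α₂` in a vector space, with the value `α₂` at `s = ∞`. -/
def veroneseCurve {W : Type*} [AddCommGroup W] [Module ℝ W] (α : Fin 3 → W)
    (s : OnePoint ℝ) : W :=
  s.elim (α 2) (fun t : ℝ => α 0 + t • α 1 + t ^ 2 • α 2)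

/-- The family `D s`, `s ∈ ℝP¹ = ℝ ∪ {∞}`, consists of the tangent distributions of the foliations
of a Veronese web on the open subset `U` of the three-dimensional manifold `M`. -/
def IsVeroneseWebOn [IsManifold (𝓡 3) ∞ M] (D : OnePoint ℝ → TangentField M) (U : Set M) : Prop :=
  (∀ s, IsFoliationOn (D s) U) ∧
    ∀ p ∈ U, ∃ V : Set M, IsOpen V ∧ p ∈ V ∧ V ⊆ U ∧
      ∃ α : Fin 3 → OneForm M, (∀ k, (α k).SmoothOn V) ∧
        ∀ x ∈ V, LinearIndependent ℝ (fun k => α k x) ∧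
          ∀ s, D s x = LinearMap.ker (veroneseCurve (fun k => α k x) s).toLinearMap

/-- The foliations `F_{λ i}`, `i = 0, 1, 2`, are `{x i = const}` over `V`, where `x : M → ℝ³`. -/
def HasCoordinateFoliationsOn (l : Fin 3 → ℝ) (D : OnePoint ℝ → TangentField M) (x : M → R3)
    (V : Set M) : Prop :=
  ∀ i, IsFirstIntegralOn (D (l i : OnePoint ℝ)) (fun q => x q i) V

end Webs

/-! ### The dispersionless Hirota equation -/

/-- The partial derivative `∂f/∂xᵢ`. -/
def pd (i : Fin 3) (f : R3 → ℝ) (x : R3) : ℝ :=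
  fderiv ℝ f x (EuclideanSpace.single i 1)

/-- `f` is, on the open set `U`, a smooth solution of the dispersionless Hirota equation with
constants `λ 0, λ 1, λ 2`, all of whose first partial derivatives vanish nowhere. -/
structure IsHirotaSolutionOn (l : Fin 3 → ℝ) (f : R3 → ℝ) (U : Set R3) : Prop where
  smooth : ContDiffOn ℝ ∞ f U
  equation : ∀ x ∈ U,
    (l 1 - l 2) * pd 0 f x * pd 1 (pd 2 f) x
      + (l 2 - l 0) * pd 1 f x * pd 2 (pd 0 f) x
      + (l 0 - l 1) * pd 2 f x * pd 0 (pd 1 f) x = 0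
  pd_ne_zero : ∀ x ∈ U, ∀ i, pd i f x ≠ 0

/-- The one-form `dxᵢ` on `ℝ³`. -/
def dcoord (i : Fin 3) : R3 →L[ℝ] ℝ := EuclideanSpace.proj i

/-- The one-form `α^s` of a function `f` at the point `x`; at `s = ∞` it is, by definition, the
coefficient of `s²` in this quadratic polynomial in `s`. -/
def hirotaForm (l : Fin 3 → ℝ) (f : R3 → ℝ) (s : OnePoint ℝ) (x : R3) : R3 →L[ℝ] ℝ :=
  s.elim
    (pd 0 f x • dcoord 0 + pd 1 f x • dcoord 1 + pd 2 f x • dcoord 2)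
    (fun t : ℝ =>
      ((l 1 - t) * (l 2 - t) * pd 0 f x) • dcoord 0
        + ((l 2 - t) * (l 0 - t) * pd 1 f x) • dcoord 1
        + ((l 0 - t) * (l 1 - t) * pd 2 f x) • dcoord 2)

/-- The family of plane fields `ker α^s`, `s ∈ ℝ ∪ {∞}`. -/
def hirotaWeb (l : Fin 3 → ℝ) (f : R3 → ℝ) (s : OnePoint ℝ) : TangentField R3 :=
  fun x => LinearMap.ker (hirotaForm l f s x).toLinearMap

/-- The relation `f ∼ g` between the germ of `f` at `p` and the germ of `g` at `q`:
`f (x₀, x₁, x₂) = ψ (g (φ₀ x₀, φ₁ x₁, φ₂ x₂))` near `p` for smooth local diffeomorphisms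
`ψ, φ₀, φ₁, φ₂` of `ℝ`, where `φ₀ × φ₁ × φ₂` takes `p` to `q`. -/
def FunEquivAt (f : R3 → ℝ) (p : R3) (g : R3 → ℝ) (q : R3) : Prop :=
  ∃ (ψ : ℝ → ℝ) (φ : Fin 3 → ℝ → ℝ),
    IsLocalDiffeomorphAt 𝓘(ℝ, ℝ) 𝓘(ℝ, ℝ) ∞ ψ (g q) ∧
    (∀ i, IsLocalDiffeomorphAt 𝓘(ℝ, ℝ) 𝓘(ℝ, ℝ) ∞ (φ i) (p i) ∧ φ i (p i) = q i) ∧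
    ∀ᶠ x in 𝓝 p, f x = ψ (g (WithLp.toLp 2 (fun i => φ i (x i))))

/-! ### Local solutions and local webs -/

/-- A solution of the Hirota equation with nonvanishing first partial derivatives, defined on
an open set of `ℝ³` with a marked point. -/
structure PointedSolution (l : Fin 3 → ℝ) where
  domain : Set R3
  isOpen_domain : IsOpen domain
  point : R3
  point_mem : point ∈ domain
  toFun : R3 → ℝ
  isSolution : IsHirotaSolutionOn l toFun domain

/-- Equivalence of pointed solutions. -/
def PointedSolution.Equiv {l : Fin 3 → ℝ} (S T : PointedSolution l) : Prop :=
  FunEquivAt S.toFun S.point T.toFun T.point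

/-- A Veronese web on an open set, with a marked point, of a smooth 3-dimensional manifold. -/
structure PointedWeb where
  M : Type
  [topology : TopologicalSpace M]
  [charted : ChartedSpace R3 M]
  [manifold : IsManifold (𝓡 3) ∞ M]
  domain : Set M
  isOpen_domain : IsOpen domain
  point : M
  point_mem : point ∈ domain
  tangent : OnePoint ℝ → TangentField M
  isWeb : IsVeroneseWebOn tangent domain

attribute [instance] PointedWeb.topology PointedWeb.charted PointedWeb.manifold

/-- Local equivalence of pointed Veronese webs: a smooth local diffeomorphism, taking the marked
point to the marked point, identifies the foliations `F_s` of the two webs for every `s`. -/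
def PointedWeb.Equiv (W W' : PointedWeb) : Prop :=
  ∃ Φ : W.M → W'.M, IsLocalDiffeomorphAt (𝓡 3) (𝓡 3) ∞ Φ W.point ∧ Φ W.point = W'.point ∧
    ∀ᶠ x in 𝓝 W.point, ∀ s : OnePoint ℝ,
      W.tangent s x =
        (W'.tangent s (Φ x)).comap (mfderiv (𝓡 3) (𝓡 3) Φ x).toLinearMap

/-- The web `W` is represented by the solution `f = S` near its marked point: there are local
coordinates `x = (x₀, x₁, x₂)` of the manifold, taking the marked point to the marked point, in
which `F_{λ i} = {x i = const}` and `F_∞ = {f (x₀, x₁, x₂) = const}`. -/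
def PointedWeb.RepresentedBy {l : Fin 3 → ℝ} (W : PointedWeb) (S : PointedSolution l) : Prop :=
  ∃ x ∈ IsManifold.maximalAtlas (𝓡 3) ∞ W.M, W.point ∈ x.source ∧ x W.point = S.point ∧
    ∃ V : Set W.M, IsOpen V ∧ W.point ∈ V ∧ V ⊆ x.source ∧
      HasCoordinateFoliationsOn l W.tangent x V ∧
      IsFirstIntegralOn (W.tangent OnePoint.infty) (fun q => S.toFun (x q)) V

end

/-! At each point a Veronese web is determined by its planes at λ₁, λ₂, λ₃ and ∞. In coordinates
with F_{λᵢ} = {xᵢ = const}, each dxᵢ is, up to a factor, the value at λᵢ of the quadratic curve α₀ +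
λα₁ + λ²α₂, and its leading coefficient α₂ is a multiple of df for a first integral f of F_∞.
Lagrange interpolation rebuilds the curve from these data; up to a scalar it is α^λ, the
coefficients being the f_{xᵢ} because df = Σ f_{xᵢ} dxᵢ (`exists_ker_veroneseCurve_eq`,
`eq_comap_hirotaWeb`). Coordinates straightening the three foliations exist because values of the
curve at three distinct nodes are independent (`exists_chart_hasCoordinateFoliationsOn`).

The Hirota equation is the integrability of this family: α^λ ∧ dα^λ is the left side of (H) times
∏(λᵢ - λ) times the volume form. Hence (H) follows from the integrability of F_λ for a single λ off
the nodes (`hirota_equation_of_ker_eq`), and conversely yields the integrability of every such α^λ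
(`fderiv_hirotaForm_symm`). At the nodes and at ∞ the functions xᵢ and f are first integrals
outright.

To pass from integrability to first integrals, the Frobenius theorem in codimension one is proved
from the inverse function theorem. The leaves of dz = η are computed along rays from the origin by
an integral equation in C([0,1]), whose solution depends smoothly on the ray and the initial value
since superposition operators are smooth (`exists_contDiffOn_integral_equation`). Integrability
makes the union of these rays tangent to the distribution (`variation_eq_of_integrable`).

For the correspondence, a solution is sent to its web on ℝ³. A representation of a web by a solution
is the same as a local equivalence with that web (`PointedWeb.representedBy_iff`). An equivalence
between the webs of f and g preserves F_{λᵢ} and F_∞. As two first integrals of one foliation are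
locally functions of each other (`exists_eq_comp_of_isFirstIntegralOn`), it is a product of maps φᵢ
of the line and relates f to g by some ψ. Conversely, such a product straightens the same foliations
(`FunEquivAt.exists_chart`). So ∼ is exactly local equivalence of webs
(`PointedSolution.equiv_iff`). -/

noncomputable section

/-! ### The inverse function theorem with a smooth inverse on an open set -/

section InverseFunction

variable {E F : Type*} [NormedAddCommGroup E] [NormedSpace ℝ E] [CompleteSpace E]
  [NormedAddCommGroup F] [NormedSpace ℝ F]

/-- The local inverse is smooth at the image of every point where the derivative is invertible.
Invertible operators form an open set, so shrinking the source to such points makes the inverse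
smooth on the whole target. -/
theorem exists_openPartialHomeomorph_of_fderiv_equiv {f : E → F} {U : Set E} (hU : IsOpen U)
    (hf : ContDiffOn ℝ ∞ f U) {a : E} (ha : a ∈ U) (f' : E ≃L[ℝ] F)
    (hf' : fderiv ℝ f a = f') :
    ∃ e : OpenPartialHomeomorph E F, a ∈ e.source ∧ e.source ⊆ U ∧ (e : E → F) = f ∧
      ContDiffOn ℝ ∞ e.symm e.target := by
  have hfa : ContDiffAt ℝ ∞ f a := hf.contDiffAt (hU.mem_nhds ha)
  have hd : HasFDerivAt f (f' : E →L[ℝ] F) a := by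
    rw [← hf']; exact (hfa.differentiableAt (by simp)).hasFDerivAt
  set e₀ := hfa.toOpenPartialHomeomorph f hd (by simp) with he₀
  have hcont : ContinuousOn (fderiv ℝ f) U := hf.continuousOn_fderiv_of_isOpen hU (by simp)
  set V : Set E := U ∩ fderiv ℝ f ⁻¹' Set.range ((↑) : (E ≃L[ℝ] F) → E →L[ℝ] F) with hV
  have hVo : IsOpen V := hcont.isOpen_inter_preimage hU ContinuousLinearEquiv.isOpen
  refine ⟨e₀.restrOpen V hVo, ?_, ?_, rfl, ?_⟩
  · rw [OpenPartialHomeomorph.restrOpen_source]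
    exact ⟨hfa.mem_toOpenPartialHomeomorph_source hd (by simp), ha, f', hf'.symm⟩
  · rw [OpenPartialHomeomorph.restrOpen_source]
    exact fun x hx => hx.2.1
  · intro y hy
    set e := e₀.restrOpen V hVo
    have hys : e.symm y ∈ e.source := e.map_target hy
    rw [OpenPartialHomeomorph.restrOpen_source] at hys
    obtain ⟨-, hyU, A, hA⟩ := hys
    refine (e.contDiffAt_symm (f₀' := A) hy ?_ ?_).contDiffWithinAt
    · rw [hA]
      exact ((hf.contDiffAt (hU.mem_nhds hyU)).differentiableAt (by simp)).hasFDerivAt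
    · exact hf.contDiffAt (hU.mem_nhds hyU)

end InverseFunction

/-! ### Superposition operators on spaces of continuous functions -/

section Superposition

variable {K : Type*} [TopologicalSpace K] [CompactSpace K]
variable {E F G : Type*} [NormedAddCommGroup E] [NormedSpace ℝ E]
  [NormedAddCommGroup F] [NormedSpace ℝ F] [NormedAddCommGroup G] [NormedSpace ℝ G]

/-- A bilinear map acting pointwise on continuous functions. -/
def pointwiseBilin (K : Type*) [TopologicalSpace K] [CompactSpace K] (B : E →L[ℝ] F →L[ℝ] G) :
    C(K, E) →L[ℝ] C(K, F) →L[ℝ] C(K, G) :=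
  LinearMap.mkContinuous₂
    (LinearMap.mk₂ ℝ (fun (u : C(K, E)) (v : C(K, F)) =>
      (⟨fun t => B (u t) (v t), by fun_prop⟩ : C(K, G)))
      (fun u u' v => by ext; simp) (fun c u v => by ext; simp)
      (fun u v v' => by ext; simp) (fun c u v => by ext; simp))
    ‖B‖ (fun u v => by
      refine (ContinuousMap.norm_le _ (by positivity)).2 fun t => ?_
      refine (B.le_opNorm₂ _ _).trans ?_
      gcongr
      · exact u.norm_coe_le_norm t
      · exact v.norm_coe_le_norm t)

/-- The mean value inequality is applied at each t on the segment from `u t` to `u t + v t`. Its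
points are values of the curves `u + s • v`, so continuity of `w ↦ h' ∘ w` in the supremum norm
gives one `δ` for all t. -/
theorem hasFDerivAt_postcomp {h : C(E, F)} {h' : C(E, E →L[ℝ] F)}
    (hh : ∀ x, HasFDerivAt h (h' x) x) (u : C(K, E)) :
    HasFDerivAt (fun w : C(K, E) => h.comp w)
      (pointwiseBilin K (ContinuousLinearMap.id ℝ (E →L[ℝ] F)) (h'.comp u)) u := by
  rw [hasFDerivAt_iff_isLittleO_nhds_zero, Asymptotics.isLittleO_iff]
  intro ε hε
  have hc : ContinuousAt (fun w : C(K, E) => h'.comp w) u :=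
    (ContinuousMap.continuous_postcomp h').continuousAt
  obtain ⟨δ, hδ, hball⟩ := (Metric.continuousAt_iff (α := C(K, E)) (β := C(K, E →L[ℝ] F))).1 hc ε hε
  filter_upwards [Metric.ball_mem_nhds (0 : C(K, E)) hδ] with v hv
  rw [mem_ball_zero_iff] at hv
  refine (ContinuousMap.norm_le _ (by positivity)).2 fun t => ?_
  have hseg : ∀ x ∈ segment ℝ (u t) (u t + v t), ‖h' x - h' (u t)‖ ≤ ε := by
    intro x hx
    rw [segment_eq_image'] at hx
    obtain ⟨s, hs, rfl⟩ := hx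
    have h1 : dist (u + s • v) u < δ := by
      rw [dist_eq_norm, add_sub_cancel_left, norm_smul, Real.norm_of_nonneg hs.1]
      exact lt_of_le_of_lt (mul_le_of_le_one_left (norm_nonneg _) hs.2) hv
    have h2 := (ContinuousMap.dist_apply_le_dist t).trans (hball h1).le
    simpa [dist_eq_norm] using h2
  have key := Convex.norm_image_sub_le_of_norm_hasFDerivWithin_le' (𝕜 := ℝ)
    (fun x _ => (hh x).hasFDerivWithinAt) hseg (convex_segment _ _)
    (left_mem_segment ℝ _ _) (right_mem_segment ℝ _ _)
  have h3 : ‖v t‖ ≤ ‖v‖ := v.norm_coe_le_norm t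
  simp only [add_sub_cancel_left] at key
  exact key.trans (by gcongr)

end Superposition

universe u

/-- The derivative is again a superposition operator, that of `fderiv ℝ h`, followed by a bounded
linear map. The induction therefore has to let the target `F` vary, and `E`, `F` share a universe so
that `E →L[ℝ] F` stays in it. -/
theorem contDiff_postcomp_nat {K : Type*} [TopologicalSpace K] [CompactSpace K]
    {E : Type u} [NormedAddCommGroup E] [NormedSpace ℝ E] (n : ℕ) :
    ∀ {F : Type u} [NormedAddCommGroup F] [NormedSpace ℝ F] (h : C(E, F)),
      ContDiff ℝ ∞ h → ContDiff ℝ n (fun w : C(K, E) => h.comp w) := by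
  induction n with
  | zero =>
    intro F _ _ h _
    exact contDiff_zero.2 (ContinuousMap.continuous_postcomp h)
  | succ n ih =>
    intro F _ _ h hh
    have hd : ContDiff ℝ ∞ (fderiv ℝ h) := hh.fderiv_right (by simp)
    let h' : C(E, E →L[ℝ] F) := ⟨fderiv ℝ h, hd.continuous⟩
    refine contDiff_succ_iff_hasFDerivAt.2
      ⟨fun u => pointwiseBilin K (ContinuousLinearMap.id ℝ (E →L[ℝ] F)) (h'.comp u), ?_, fun u =>
        hasFDerivAt_postcomp (fun x => (hh.differentiable (by simp) x).hasFDerivAt) u⟩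
    exact (ContinuousLinearMap.contDiff _).comp (ih h' hd)

/-- The superposition operator of a smooth map is smooth. -/
theorem contDiff_postcomp {K : Type*} [TopologicalSpace K] [CompactSpace K]
    {E F : Type u} [NormedAddCommGroup E] [NormedSpace ℝ E]
    [NormedAddCommGroup F] [NormedSpace ℝ F] {h : C(E, F)}
    (hh : ContDiff ℝ ∞ h) : ContDiff ℝ ∞ (fun w : C(K, E) => h.comp w) :=
  contDiff_infty.2 fun n => contDiff_postcomp_nat n h hh

/-! ### Integral equations depending on parameters -/

section IntegralEquation

open unitInterval

/-- The operator `v ↦ (s ↦ ∫₀ˢ v)` on continuous functions on the unit interval. -/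
def volterra : C(I, ℝ) →L[ℝ] C(I, ℝ) :=
  LinearMap.mkContinuous
    { toFun := fun v => ⟨fun s => ∫ r in (0 : ℝ)..s, v (Set.projIcc 0 1 zero_le_one r), by
        have : Continuous fun r : ℝ => v (Set.projIcc 0 1 zero_le_one r) :=
          v.continuous.comp continuous_projIcc
        exact (intervalIntegral.continuous_primitive (fun a b => this.intervalIntegrable a b)
          0).comp continuous_subtype_val⟩
      map_add' := fun v w => by
        ext s
        exact intervalIntegral.integral_add
          ((v.continuous.comp continuous_projIcc).intervalIntegrable _ _)
          ((w.continuous.comp continuous_projIcc).intervalIntegrable _ _)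
      map_smul' := fun c v => by
        ext s
        exact intervalIntegral.integral_smul c _ }
    1 (fun v => by
      refine (ContinuousMap.norm_le _ (by positivity)).2 fun s => ?_
      have h := intervalIntegral.norm_integral_le_of_norm_le_const (a := (0 : ℝ)) (b := s)
        (f := fun r => v (Set.projIcc 0 1 zero_le_one r)) (C := ‖v‖)
        (fun r _ => v.norm_coe_le_norm _)
      refine h.trans ?_
      rw [sub_zero, abs_of_nonneg s.2.1, one_mul]
      exact mul_le_of_le_one_right (norm_nonneg _) s.2.2)

theorem volterra_apply (v : C(I, ℝ)) (s : I) :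
    volterra v s = ∫ r in (0 : ℝ)..s, v (Set.projIcc 0 1 zero_le_one r) := rfl

variable {H : Type} [NormedAddCommGroup H] [NormedSpace ℝ H]

/-- The curve `s ↦ (k, 0, a s)` as a function of `(k, a)`. -/
def curveLin : H × C(I, ℝ) →L[ℝ] C(I, H × ℝ × ℝ) :=
  LinearMap.mkContinuous
    { toFun := fun x => ⟨fun s => (x.1, 0, x.2 s), by fun_prop⟩
      map_add' := fun x y => by ext s <;> simp
      map_smul' := fun c x => by ext s <;> simp }
    1 (fun x => by
      refine (ContinuousMap.norm_le _ (by positivity)).2 fun s => ?_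
      have h1 : ‖x.2 s‖ ≤ ‖x.2‖ := x.2.norm_coe_le_norm s
      simp only [LinearMap.coe_mk, AddHom.coe_mk, ContinuousMap.coe_mk, one_mul, Prod.norm_def,
        norm_zero]
      exact max_le_max le_rfl (max_le (norm_nonneg _) h1))

@[simp]
theorem curveLin_apply (x : H × C(I, ℝ)) (s : I) : curveLin x s = (x.1, 0, x.2 s) := rfl

/-- The curve `s ↦ (h, s, u s)` as a function of `(h, u)`. -/
def curve (x : H × C(I, ℝ)) : C(I, H × ℝ × ℝ) :=
  curveLin x + ⟨fun s => (0, (s : ℝ), 0), by fun_prop⟩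

@[simp]
theorem curve_apply (x : H × C(I, ℝ)) (s : I) : curve x s = (x.1, (s : ℝ), x.2 s) := by
  simp [curve]

theorem contDiff_curve : ContDiff ℝ ∞ (curve (H := H)) := by
  have h : ContDiff ℝ ∞ fun x : H × C(I, ℝ) => curveLin x :=
    ContinuousLinearMap.contDiff (E := H × C(I, ℝ)) (F := C(I, H × ℝ × ℝ)) curveLin
  exact h.add contDiff_const

theorem hasFDerivAt_curve (x : H × C(I, ℝ)) : HasFDerivAt (curve (H := H)) curveLin x := by
  have h : HasFDerivAt (fun x : H × C(I, ℝ) => curveLin x) curveLin x :=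
    ContinuousLinearMap.hasFDerivAt (E := H × C(I, ℝ)) (F := C(I, H × ℝ × ℝ)) curveLin
  exact h.add_const _

/-- A smooth function of three variables, with its derivative, acting on curves. -/
theorem hasFDerivAt_postcomp_curve {f : C(H × ℝ × ℝ, ℝ)} (hf : ContDiff ℝ ∞ f)
    (x : H × C(I, ℝ)) :
    ∃ N : H × C(I, ℝ) →L[ℝ] C(I, ℝ),
      HasFDerivAt (fun x => volterra (f.comp (curve x))) (volterra.comp N) x ∧
      ∀ y s, N y s = fderiv ℝ f (curve x s) (y.1, 0, y.2 s) := by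
  let f' : C(H × ℝ × ℝ, H × ℝ × ℝ →L[ℝ] ℝ) :=
    ⟨fderiv ℝ f, (hf.fderiv_right (m := ∞) (by simp)).continuous⟩
  refine ⟨_, volterra.hasFDerivAt.comp x ((hasFDerivAt_postcomp (h' := f') (fun z =>
    (hf.differentiable (by simp) z).hasFDerivAt) (curve x)).comp x (hasFDerivAt_curve x)), ?_⟩
  intro y s
  rfl

/-- Local solutions of `u s = z + ∫₀ˢ f (h, r, u r) dr`, depending smoothly on `(h, z)`, when
`f` vanishes for `h = 0`. -/
theorem exists_contDiffOn_integral_equation [CompleteSpace H] {f : C(H × ℝ × ℝ, ℝ)}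
    (hf : ContDiff ℝ ∞ f) (hf0 : ∀ x, f (0, x) = 0) :
    ∃ (W : Set (H × ℝ)) (u : H × ℝ → C(I, ℝ)), IsOpen W ∧ 0 ∈ W ∧ ContDiffOn ℝ ∞ u W ∧
      u 0 = 0 ∧
      ∀ c ∈ W, u c = ContinuousMap.const I c.2 + volterra (f.comp (curve (c.1, u c))) := by
  let cst : ℝ →L[ℝ] C(I, ℝ) := LinearMap.mkContinuous
    { toFun := fun z => ContinuousMap.const I z
      map_add' := fun x y => by ext s; simp
      map_smul' := fun c x => by ext s; simp } 1 (fun x => by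
        refine (ContinuousMap.norm_le _ (by positivity)).2 fun s => ?_
        simp)
  have hcst : ∀ z, cst z = ContinuousMap.const I z := fun z => rfl
  -- The equation is `G = 0`, to be solved for the curve in terms of the parameters `(h, z)`.
  let G : (H × ℝ) × C(I, ℝ) → C(I, ℝ) := fun x =>
    x.2 - cst x.1.2 - volterra (f.comp (curve (x.1.1, x.2)))
  have hG : ContDiff ℝ ∞ G := by
    refine (contDiff_snd.sub (cst.contDiff.comp (contDiff_snd.comp contDiff_fst))).sub
      (volterra.contDiff.comp ((contDiff_postcomp hf).comp (contDiff_curve.comp ?_)))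
    fun_prop
  have hf0c : ∀ u, f.comp (curve ((0 : H), u)) = 0 := by
    intro u; ext s; simp [hf0]
  have hG0 : G 0 = 0 := by
    simp [G, hf0c]
  -- For `h = 0` the integral term vanishes identically, so `G` restricted to the curve variable is
  -- the identity. No contraction estimate is needed: `h` being small plays the role of a short time
  -- interval.
  have hGd : ∀ u, fderiv ℝ G 0 (0, u) = u := by
    intro u
    have h1 : HasFDerivAt G (fderiv ℝ G 0) (ContinuousLinearMap.inr ℝ (H × ℝ) C(I, ℝ) 0) := by
      rw [map_zero]; exact (hG.differentiable (by simp) 0).hasFDerivAt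
    have h2 := h1.comp (0 : C(I, ℝ)) (ContinuousLinearMap.hasFDerivAt _)
    have h3 : (G ∘ (ContinuousLinearMap.inr ℝ (H × ℝ) C(I, ℝ))) = id := by
      funext v
      simp [G, hf0c]
    rw [h3] at h2
    have := h2.unique (hasFDerivAt_id _)
    simpa using DFunLike.congr_fun this u
  let Ψ : (H × ℝ) × C(I, ℝ) → (H × ℝ) × C(I, ℝ) := fun x => (x.1, G x)
  have hΨ : ContDiff ℝ ∞ Ψ := contDiff_fst.prodMk hG
  let A : ((H × ℝ) × C(I, ℝ)) ≃L[ℝ] ((H × ℝ) × C(I, ℝ)) :=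
    (ContinuousLinearEquiv.refl ℝ _).skewProd (ContinuousLinearEquiv.refl ℝ _)
      ((fderiv ℝ G 0).comp (ContinuousLinearMap.inl ℝ _ _))
  have hA : fderiv ℝ Ψ 0 = A := by
    have : HasFDerivAt Ψ ((ContinuousLinearMap.fst ℝ _ _).prod (fderiv ℝ G 0)) 0 :=
      hasFDerivAt_fst.prodMk (hG.differentiable (by simp) 0).hasFDerivAt
    rw [this.fderiv]
    refine ContinuousLinearMap.ext fun x => ?_
    have h4 : fderiv ℝ G 0 x = x.2 + fderiv ℝ G 0 (x.1, 0) := by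
      conv_lhs => rw [show x = (0, x.2) + (x.1, 0) by ext <;> simp]
      rw [map_add, hGd]
    simp [A, ContinuousLinearEquiv.skewProd_apply, h4]
  obtain ⟨e, he0, -, hee, hes⟩ := exists_openPartialHomeomorph_of_fderiv_equiv isOpen_univ
    hΨ.contDiffOn (Set.mem_univ 0) A hA
  have hΨ0 : Ψ 0 = 0 := by simp [Ψ, hG0]
  have h0t : (0 : (H × ℝ) × C(I, ℝ)) ∈ e.target := by
    have := e.map_source he0
    rwa [hee, hΨ0] at this
  have hsymm0 : e.symm 0 = 0 := by
    have := e.left_inv he0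
    rwa [hee, hΨ0] at this
  have hinl : Continuous fun c : H × ℝ => (c, (0 : C(I, ℝ))) := by fun_prop
  refine ⟨(fun c : H × ℝ => (c, (0 : C(I, ℝ)))) ⁻¹' e.target, fun c => (e.symm (c, 0)).2,
    e.open_target.preimage hinl, h0t, ?_, ?_, ?_⟩
  · refine contDiff_snd.comp_contDiffOn (hes.comp ?_ fun c hc => hc)
    fun_prop
  · change (e.symm 0).2 = 0
    rw [hsymm0]; rfl
  · intro c hc
    have h5 : Ψ (e.symm (c, 0)) = (c, 0) := by
      have := e.right_inv hc
      rwa [hee] at this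
    have h6 : (e.symm (c, 0)).1 = c := congrArg Prod.fst h5
    have h7 : G (e.symm (c, 0)) = 0 := congrArg Prod.snd h5
    simp only [G, h6, hcst] at h7
    rwa [sub_sub, sub_eq_zero] at h7

end IntegralEquation

/-! ### The Frobenius theorem in codimension one -/

section Frobenius

open unitInterval

variable {H : Type} [NormedAddCommGroup H] [NormedSpace ℝ H]

/-- The function `(h, s, y) ↦ η (s h, y) h` which governs the leaves of `dz = η` over rays. -/
def rayFun (η : H × ℝ → H →L[ℝ] ℝ) (hη : ContDiff ℝ ∞ η) : C(H × ℝ × ℝ, ℝ) :=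
  ⟨fun x => η (x.2.1 • x.1, x.2.2) x.1, by
    have := hη.continuous
    fun_prop⟩

theorem rayFun_apply (η : H × ℝ → H →L[ℝ] ℝ) (hη : ContDiff ℝ ∞ η) (x : H × ℝ × ℝ) :
    rayFun η hη x = η (x.2.1 • x.1, x.2.2) x.1 := rfl

theorem contDiff_rayFun (η : H × ℝ → H →L[ℝ] ℝ) (hη : ContDiff ℝ ∞ η) :
    ContDiff ℝ ∞ (rayFun η hη) := by
  refine ContDiff.clm_apply (hη.comp ?_) contDiff_fst
  fun_prop

/-- This is the integrand of the linearised equation, with time held fixed. The vector `h` enters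
twice, in the base point `s • h` and as the argument of `η`, whence the two terms. -/
theorem fderiv_rayFun (η : H × ℝ → H →L[ℝ] ℝ) (hη : ContDiff ℝ ∞ η) (h k : H) (s y a : ℝ) :
    fderiv ℝ (rayFun η hη) (h, s, y) (k, 0, a) =
      fderiv ℝ η (s • h, y) (s • k, a) h + η (s • h, y) k := by
  have h0 : HasFDerivAt η (fderiv ℝ η (s • h, y)) (s • h, y) :=
    (hη.differentiable (by simp) _).hasFDerivAt
  have hp : HasFDerivAt (fun x : H × ℝ × ℝ => (x.2.1 • x.1, x.2.2))
      ((s • ContinuousLinearMap.fst ℝ H (ℝ × ℝ) + ((ContinuousLinearMap.fst ℝ ℝ ℝ).comp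
        (ContinuousLinearMap.snd ℝ H (ℝ × ℝ))).smulRight h).prod ((ContinuousLinearMap.snd ℝ ℝ ℝ).comp
        (ContinuousLinearMap.snd ℝ H (ℝ × ℝ)))) (h, s, y) :=
    HasFDerivAt.prodMk
      (HasFDerivAt.smul (c := fun x : H × ℝ × ℝ => x.2.1) (f := fun x : H × ℝ × ℝ => x.1)
        (hasFDerivAt_fst.comp (h, s, y) hasFDerivAt_snd) hasFDerivAt_fst)
      (hasFDerivAt_snd.comp (h, s, y) hasFDerivAt_snd)
  have h1 : HasFDerivAt (rayFun η hη) _ (h, s, y) :=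
    (HasFDerivAt.comp (h, s, y) (g := η) h0 hp).clm_apply hasFDerivAt_fst
  rw [h1.fderiv]
  simp [add_comm]

/-- Along a ray of the leaf of `dz = η`, the variation `A` of the leaf in the direction `k` agrees
with `s η k`. -/
theorem variation_eq_of_integrable {η : H × ℝ → H →L[ℝ] ℝ} (hη : ContDiff ℝ ∞ η) {h k : H}
    {U A : ℝ → ℝ} (hA0 : A 0 = 0)
    (hUd : ∀ s ∈ Set.Icc (0 : ℝ) 1, HasDerivAt U (η (s • h, U s) h) s)
    (hAd : ∀ s ∈ Set.Icc (0 : ℝ) 1,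
      HasDerivAt A (fderiv ℝ η (s • h, U s) (s • k, A s) h + η (s • h, U s) k) s)
    (hint : ∀ s ∈ Set.Icc (0 : ℝ) 1, fderiv ℝ η (s • h, U s) (k, η (s • h, U s) k) h =
      fderiv ℝ η (s • h, U s) (h, η (s • h, U s) h) k) :
    A 1 = η (h, U 1) k := by
  -- `B` is the variation that tangency to the distribution would prescribe. By integrability `A -
  -- B` satisfies the homogeneous linear equation with coefficient `m`, and it vanishes at 0, hence
  -- on the whole interval by Grönwall's inequality.
  set B : ℝ → ℝ := fun s => s * η (s • h, U s) k with hB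
  set m : ℝ → ℝ := fun s => fderiv ℝ η (s • h, U s) (0, 1) h with hm
  have hCd : ∀ s ∈ Set.Icc (0 : ℝ) 1,
      HasDerivAt (fun s => A s - B s) (m s * (A s - B s)) s := by
    intro s hs
    have hη1 : HasFDerivAt η (fderiv ℝ η (s • h, U s)) (s • h, U s) :=
      (hη.differentiable (by simp) _).hasFDerivAt
    have hp : HasDerivAt (fun s : ℝ => ((s • h, U s) : H × ℝ)) (h, η (s • h, U s) h) s := by
      refine HasDerivAt.prodMk ?_ (hUd s hs)
      simpa using (hasDerivAt_id s).smul_const h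
    have hη2 : HasDerivAt (fun s => η (s • h, U s))
        (fderiv ℝ η (s • h, U s) (h, η (s • h, U s) h)) s :=
      HasFDerivAt.comp_hasDerivAt (l := η) (f := fun s : ℝ => ((s • h, U s) : H × ℝ)) s hη1 hp
    have hη3 : HasDerivAt (fun s => η (s • h, U s) k)
        (fderiv ℝ η (s • h, U s) (h, η (s • h, U s) h) k) s := by
      simpa using hη2.clm_apply (hasDerivAt_const s k)
    have hB1 : HasDerivAt B (1 * η (s • h, U s) k +
        s * fderiv ℝ η (s • h, U s) (h, η (s • h, U s) h) k) s :=
      (hasDerivAt_id s).mul hη3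
    have hi := hint s hs
    refine ((hAd s hs).sub hB1).congr_deriv ?_
    have e1 : ((s • k, A s) : H × ℝ) = s • (k, η (s • h, U s) k) + (A s - B s) • (0, 1) := by
      ext
      · simp
      · simp [hB]
    rw [e1, map_add, map_smul, map_smul]
    simp only [add_apply, smul_apply, smul_eq_mul, hi, hm]
    ring
  have hUc : ContinuousOn U (Set.Icc 0 1) := fun s hs => (hUd s hs).continuousAt.continuousWithinAt
  have hmc : ContinuousOn m (Set.Icc 0 1) := by
    have hfc : Continuous (fderiv ℝ η) := (hη.fderiv_right (m := ∞) (by simp)).continuous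
    have h1 : ContinuousOn (fun s : ℝ => ((s • h, U s) : H × ℝ)) (Set.Icc 0 1) := by fun_prop
    exact ((hfc.comp_continuousOn h1).clm_apply continuousOn_const).clm_apply continuousOn_const
  obtain ⟨K, hK⟩ := isCompact_Icc.exists_bound_of_continuousOn hmc
  have hzero := eq_zero_of_abs_deriv_le_mul_abs_self_of_eq_zero_right
    (f := fun s => A s - B s) (f' := fun s => m s * (A s - B s)) (K := K) (a := 0) (b := 1)
    (fun s hs => (hCd s hs).continuousAt.continuousWithinAt)
    (fun s hs => (hCd s (Set.Ico_subset_Icc_self hs)).hasDerivWithinAt)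
    (by simp [hA0, hB])
    (fun s hs => by
      rw [norm_mul]
      exact mul_le_mul_of_nonneg_right (hK s (Set.Ico_subset_Icc_self hs)) (norm_nonneg _))
    1 (Set.right_mem_Icc.2 zero_le_one)
  simp only [hB, one_smul, one_mul] at hzero
  linarith

/-- The leaf of `dz = η` through `(0, z)`, computed along the ray through `h`, is tangent to
`dz = η` at its end. -/
theorem fderiv_endpoint_of_integral_equation {η : H × ℝ → H →L[ℝ] ℝ} (hη : ContDiff ℝ ∞ η)
    {W : Set (H × ℝ)} (hW : IsOpen W) {u : H × ℝ → C(I, ℝ)} (hu : ContDiffOn ℝ ∞ u W)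
    (heq : ∀ c ∈ W, u c = ContinuousMap.const I c.2 +
      volterra ((rayFun η hη).comp (curve (c.1, u c))))
    {c : H × ℝ} (hc : c ∈ W)
    (hint : ∀ s : I, ∀ h k : H, fderiv ℝ η ((s : ℝ) • c.1, u c s) (k, η ((s : ℝ) • c.1, u c s) k) h =
      fderiv ℝ η ((s : ℝ) • c.1, u c s) (h, η ((s : ℝ) • c.1, u c s) h) k) (k : H) :
    fderiv ℝ u c (k, 0) 1 = η (c.1, u c 1) k := by
  obtain ⟨h, z⟩ := c
  set f := rayFun η hη with hf
  have hfs : ContDiff ℝ ∞ f := contDiff_rayFun η hη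
  set v : C(I, ℝ) := u (h, z) with hv
  set a : C(I, ℝ) := fderiv ℝ u (h, z) (k, 0) with ha
  -- the linearised integral equation
  obtain ⟨N, hN, hNa⟩ := hasFDerivAt_postcomp_curve hfs (h, v)
  have hud : HasFDerivAt u (fderiv ℝ u (h, z)) (h, z) :=
    ((hu.contDiffAt (hW.mem_nhds hc)).differentiableAt (by simp)).hasFDerivAt
  have hlin : a = volterra (N (k, a)) := by
    have hl : HasDerivAt (fun t : ℝ => ((h, z) : H × ℝ) + t • (k, (0 : ℝ))) (k, (0 : ℝ)) 0 := by
      simpa using ((hasDerivAt_id (0 : ℝ)).smul_const (k, (0 : ℝ))).const_add (h, z)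
    have hud' : HasFDerivAt u (fderiv ℝ u (h, z)) (((h, z) : H × ℝ) + (0 : ℝ) • (k, (0 : ℝ))) := by
      simpa using hud
    have h1 : HasDerivAt (fun t : ℝ => u ((h, z) + t • (k, (0 : ℝ)))) a 0 :=
      hud'.comp_hasDerivAt (0 : ℝ) hl
    have hk : HasDerivAt (fun t : ℝ => h + t • k) k 0 := by
      simpa using ((hasDerivAt_id (0 : ℝ)).smul_const k).const_add h
    have h2 : HasDerivAt (fun t : ℝ => (h + t • k, u ((h, z) + t • (k, (0 : ℝ))))) (k, a) 0 :=
      hk.prodMk h1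
    have hN' : HasFDerivAt (fun x => volterra (f.comp (curve x))) (volterra.comp N)
        ((fun t : ℝ => (h + t • k, u ((h, z) + t • (k, (0 : ℝ))))) 0) := by
      simpa using hN
    have h3 := (hN'.comp_hasDerivAt (0 : ℝ) h2).const_add (ContinuousMap.const I z)
    have hmem : ∀ᶠ t : ℝ in 𝓝 0, ((h, z) : H × ℝ) + t • (k, (0 : ℝ)) ∈ W := by
      refine hl.continuousAt.eventually_mem (hW.mem_nhds ?_)
      simpa using hc
    refine h1.unique (h3.congr_of_eventuallyEq ?_)
    filter_upwards [hmem] with t ht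
    have := heq _ ht
    simpa using this
  -- extension of both curves to the real line
  set pr : ℝ → I := Set.projIcc 0 1 zero_le_one with hpr
  have hprc : Continuous pr := continuous_projIcc
  set U : ℝ → ℝ := fun s => z + ∫ r in (0 : ℝ)..s, f (h, (pr r : ℝ), v (pr r)) with hU
  set A : ℝ → ℝ := fun s => ∫ r in (0 : ℝ)..s, fderiv ℝ f (h, (pr r : ℝ), v (pr r)) (k, 0, a (pr r))
    with hA
  have hUv : ∀ s : I, U s = v s := by
    intro s
    have := DFunLike.congr_fun (heq _ hc) s
    rw [← hv] at this
    simp only [ContinuousMap.add_apply, ContinuousMap.const_apply, volterra_apply,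
      ContinuousMap.comp_apply, curve_apply] at this
    exact this.symm
  have hAa : ∀ s : I, A s = a s := by
    intro s
    have := DFunLike.congr_fun hlin s
    simp only [volterra_apply, hNa, curve_apply] at this
    exact this.symm
  have hprs : ∀ s ∈ Set.Icc (0 : ℝ) 1, (pr s : ℝ) = s := fun s hs => by
    simp [hpr, Set.projIcc_of_mem zero_le_one hs]
  have hUp : ∀ s ∈ Set.Icc (0 : ℝ) 1, v (pr s) = U s := fun s hs => by
    rw [← hUv, hprs s hs]
  have hAp : ∀ s ∈ Set.Icc (0 : ℝ) 1, a (pr s) = A s := fun s hs => by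
    rw [← hAa, hprs s hs]
  have hUd : ∀ s ∈ Set.Icc (0 : ℝ) 1, HasDerivAt U (η (s • h, U s) h) s := by
    intro s hs
    have hcont : Continuous fun r => f (h, (pr r : ℝ), v (pr r)) := by fun_prop
    have := (hcont.integral_hasStrictDerivAt 0 s).hasDerivAt.const_add z
    rw [hf, rayFun_apply, hprs s hs, hUp s hs] at this
    exact this
  have hAd : ∀ s ∈ Set.Icc (0 : ℝ) 1,
      HasDerivAt A (fderiv ℝ η (s • h, U s) (s • k, A s) h + η (s • h, U s) k) s := by
    intro s hs
    have hfc : Continuous (fderiv ℝ f) := (hfs.fderiv_right (m := ∞) (by simp)).continuous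
    have hcont : Continuous fun r => fderiv ℝ f (h, (pr r : ℝ), v (pr r)) (k, 0, a (pr r)) := by
      fun_prop
    have := (hcont.integral_hasStrictDerivAt 0 s).hasDerivAt
    rw [hprs s hs, hUp s hs, hAp s hs, hf, fderiv_rayFun] at this
    exact this
  have hfin := variation_eq_of_integrable hη (h := h) (k := k) (U := U) (A := A) (by simp [hA])
    hUd hAd (fun s hs => by
      have hi := hint (pr s) h k
      simp only at hi
      rwa [hprs s hs, hUp s hs] at hi)
  have hA1 := hAa 1
  have hU1 := hUv 1
  simp only [Set.Icc.coe_one] at hA1 hU1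
  rw [← hA1, ← hU1, hfin]

/-- **Frobenius theorem** in codimension one, for a graph distribution `dz = η`. -/
theorem exists_firstIntegral_of_integrable_graph [CompleteSpace H] {η : H × ℝ → H →L[ℝ] ℝ}
    (hη : ContDiff ℝ ∞ η)
    (hint : ∀ᶠ x in 𝓝 (0 : H × ℝ), ∀ h k : H,
      fderiv ℝ η x (k, η x k) h = fderiv ℝ η x (h, η x h) k) :
    ∃ (V : Set (H × ℝ)) (g : H × ℝ → ℝ), IsOpen V ∧ 0 ∈ V ∧ ContDiffOn ℝ ∞ g V ∧
      ∀ x ∈ V, ∃ c : ℝ, c ≠ 0 ∧ ∀ v : H × ℝ, v.2 - η x v.1 = c * fderiv ℝ g x v := by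
  obtain ⟨W, u, hW, h0W, hu, hu0, heq⟩ := exists_contDiffOn_integral_equation
    (contDiff_rayFun η hη) (fun x => by simp [rayFun_apply])
  obtain ⟨ε, hε, hball⟩ := Metric.eventually_nhds_iff.1 hint
  -- parameters for which the curve remains in the region of integrability
  have hucont : ContinuousAt u 0 := (hu.contDiffAt (hW.mem_nhds h0W)).continuousAt
  have hsmall : ∀ᶠ c in 𝓝 (0 : H × ℝ), c ∈ W ∧ ‖c‖ < ε ∧ ‖u c‖ < ε := by
    refine (hW.eventually_mem h0W).and (.and ?_ ?_)
    · filter_upwards [Metric.ball_mem_nhds (0 : H × ℝ) hε] with c hc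
      simpa using hc
    · have : ContinuousAt (fun c => ‖u c‖) 0 := hucont.norm
      exact this.eventually_lt continuousAt_const (by simpa [hu0] using hε)
  obtain ⟨W', hW's, hW'o, h0W'⟩ := eventually_nhds_iff.1 hsmall
  -- `Z (h, z)` is the height over `h` of the leaf through `(0, z)`. The map `(h, z) ↦ (h, Z (h,
  -- z))` carries horizontal slices to leaves, so the last component of its inverse is the first
  -- integral.
  set Z : H × ℝ → ℝ := fun c => u c 1 with hZ
  let ev : C(I, ℝ) →L[ℝ] ℝ := ContinuousMap.evalCLM ℝ (1 : I)
  have hZs : ContDiffOn ℝ ∞ Z W' :=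
    (ContinuousLinearMap.contDiff (E := C(I, ℝ)) (F := ℝ) ev).comp_contDiffOn (hu.mono fun c hc => (hW's c hc).1)
  have hZ0 : ∀ z, (0, z) ∈ W' → Z (0, z) = z := by
    intro z hz
    have := DFunLike.congr_fun (heq _ (hW's _ hz).1) 1
    simpa [volterra_apply, rayFun_apply] using this
  have hZd : ∀ c ∈ W', ∀ k, fderiv ℝ Z c (k, 0) = η (c.1, Z c) k := by
    intro c hc k
    obtain ⟨hcW, hcn, hun⟩ := hW's c hc
    have hud : HasFDerivAt u (fderiv ℝ u c) c :=
      ((hu.contDiffAt (hW.mem_nhds hcW)).differentiableAt (by simp)).hasFDerivAt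
    have h1 : HasFDerivAt Z (ev.comp (fderiv ℝ u c)) c :=
      (ContinuousLinearMap.hasFDerivAt (E := C(I, ℝ)) (F := ℝ) ev).comp c hud
    rw [h1.fderiv]
    refine fderiv_endpoint_of_integral_equation hη hW hu heq hcW (fun s => hball ?_) k
    rw [dist_zero_right, Prod.norm_def, max_lt_iff]
    refine ⟨?_, ((u c).norm_coe_le_norm s).trans_lt hun⟩
    rw [norm_smul, Real.norm_of_nonneg s.2.1]
    exact ((mul_le_of_le_one_left (norm_nonneg _) s.2.2).trans (norm_fst_le c)).trans_lt hcn
  have hZdiff : ∀ c ∈ W', HasFDerivAt Z (fderiv ℝ Z c) c := fun c hc =>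
    ((hZs.contDiffAt (hW'o.mem_nhds hc)).differentiableAt (by simp)).hasFDerivAt
  have hZ1 : fderiv ℝ Z 0 (0, 1) = 1 := by
    have h1 : HasFDerivAt Z (fderiv ℝ Z 0) (ContinuousLinearMap.inr ℝ H ℝ 0) := by
      rw [map_zero]; exact hZdiff 0 h0W'
    have h2 := h1.comp (0 : ℝ) (ContinuousLinearMap.hasFDerivAt _)
    have h3 : (Z ∘ ContinuousLinearMap.inr ℝ H ℝ) =ᶠ[𝓝 0] id := by
      have : ∀ᶠ z in 𝓝 (0 : ℝ), ContinuousLinearMap.inr ℝ H ℝ z ∈ W' :=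
        (ContinuousLinearMap.inr ℝ H ℝ).continuous.continuousAt.eventually_mem
          (hW'o.mem_nhds (by rwa [map_zero]))
      filter_upwards [this] with z hz
      exact hZ0 z hz
    have := h2.unique ((hasFDerivAt_id (0 : ℝ)).congr_of_eventuallyEq h3)
    simpa using DFunLike.congr_fun this 1
  set Ψ : H × ℝ → H × ℝ := fun c => (c.1, Z c) with hΨ
  have hΨs : ContDiffOn ℝ ∞ Ψ W' := contDiff_fst.contDiffOn.prodMk hZs
  have hΨd : ∀ c ∈ W', HasFDerivAt Ψ ((ContinuousLinearMap.fst ℝ H ℝ).prod (fderiv ℝ Z c)) c :=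
    fun c hc => hasFDerivAt_fst.prodMk (hZdiff c hc)
  have hsplit : ∀ c (v : H × ℝ), fderiv ℝ Z c v = v.2 * fderiv ℝ Z c (0, 1) + fderiv ℝ Z c (v.1, 0) := by
    intro c v
    conv_lhs => rw [show v = v.2 • ((0 : H), (1 : ℝ)) + (v.1, 0) by ext <;> simp]
    rw [map_add, map_smul, smul_eq_mul]
  let A : (H × ℝ) ≃L[ℝ] (H × ℝ) :=
    (ContinuousLinearEquiv.refl ℝ _).skewProd (ContinuousLinearEquiv.refl ℝ _)
      ((fderiv ℝ Z 0).comp (ContinuousLinearMap.inl ℝ _ _))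
  have hA : fderiv ℝ Ψ 0 = A := by
    rw [(hΨd 0 h0W').fderiv]
    refine ContinuousLinearMap.ext fun x => ?_
    have := hsplit 0 x
    rw [hZ1, mul_one] at this
    simp [A, ContinuousLinearEquiv.skewProd_apply, this]
  obtain ⟨e, he0, heW, hee, hes⟩ := exists_openPartialHomeomorph_of_fderiv_equiv hW'o hΨs h0W' A hA
  have hΨ0 : Ψ 0 = 0 := by
    have : Z 0 = 0 := hZ0 0 h0W'
    simp [hΨ, this]
  refine ⟨e.target, fun x => (e.symm x).2, e.open_target, ?_, contDiff_snd.comp_contDiffOn hes, ?_⟩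
  · have := e.map_source he0
    rwa [hee, hΨ0] at this
  · intro x hx
    have hy : e.symm x ∈ W' := heW (e.map_target hx)
    set y := e.symm x with hyx
    have hΨy : Ψ y = x := by
      have := e.right_inv hx
      rwa [hee] at this
    have hsd : HasFDerivAt e.symm (fderiv ℝ e.symm x) x :=
      ((hes.contDiffAt (e.open_target.mem_nhds hx)).differentiableAt (by simp)).hasFDerivAt
    have hcomp1 : ∀ v, Prod.mk (fderiv ℝ e.symm x v).1 (fderiv ℝ Z y (fderiv ℝ e.symm x v)) = v := by
      intro v
      have h1 := (hΨd y hy).comp x hsd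
      have h2 : Ψ ∘ e.symm =ᶠ[𝓝 x] id := by
        filter_upwards [e.open_target.mem_nhds hx] with x' hx'
        have := e.right_inv hx'
        rwa [hee] at this
      have := h1.unique ((hasFDerivAt_id x).congr_of_eventuallyEq h2)
      exact DFunLike.congr_fun this v
    have hcomp2 : ∀ w, fderiv ℝ e.symm x (w.1, fderiv ℝ Z y w) = w := by
      intro w
      have hsd' : HasFDerivAt e.symm (fderiv ℝ e.symm x) (Ψ y) := by rwa [hΨy]
      have h1 := hsd'.comp y (hΨd y hy)
      have h2 : e.symm ∘ Ψ =ᶠ[𝓝 y] id := by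
        filter_upwards [e.open_source.mem_nhds (e.map_target hx)] with y' hy'
        have := e.left_inv hy'
        rwa [hee] at this
      have := h1.unique ((hasFDerivAt_id y).congr_of_eventuallyEq h2)
      exact DFunLike.congr_fun this w
    have hg : ∀ v, fderiv ℝ (fun x => (e.symm x).2) x v = (fderiv ℝ e.symm x v).2 := by
      intro v
      have := (hasFDerivAt_snd (𝕜 := ℝ) (E := H) (F := ℝ)).comp x hsd
      have h2 : HasFDerivAt (fun x => (e.symm x).2)
        ((ContinuousLinearMap.snd ℝ H ℝ).comp (fderiv ℝ e.symm x)) x := this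
      rw [h2.fderiv]; rfl
    -- Differentiating `Z (h, g (h, z)) = z` gives `dz - η = (∂Z/∂z) dg`. The factor is nonzero, as
    -- otherwise the vertical vector would be in the kernel of the invertible derivative of `Ψ`.
    refine ⟨fderiv ℝ Z y (0, 1), ?_, ?_⟩
    · intro h0
      have h1 := hcomp2 (0, 1)
      simp only [h0] at h1
      have h2 : fderiv ℝ e.symm x ((0 : H), (0 : ℝ)) = 0 := map_zero _
      rw [h2] at h1
      simpa using congrArg Prod.snd h1
    · intro v
      have h1 := hcomp1 v
      have h2 : (fderiv ℝ e.symm x v).1 = v.1 := (Prod.ext_iff.1 h1).1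
      have h3 : fderiv ℝ Z y (fderiv ℝ e.symm x v) = v.2 := (Prod.ext_iff.1 h1).2
      rw [hsplit, hZd y hy, h2] at h3
      have h4 : (y.1, Z y) = x := hΨy
      rw [h4] at h3
      rw [hg, ← h3]
      ring

end Frobenius

/-! ### From graph distributions to general one-forms -/

section Frobenius

variable {E : Type*} [NormedAddCommGroup E] [NormedSpace ℝ E]

/-- Multiplication by a bump function. The superposition operators above require globally smooth
functions, whereas the forms are given only near a point. -/
theorem exists_contDiff_eventuallyEq [FiniteDimensional ℝ E] {F : Type*} [NormedAddCommGroup F]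
    [NormedSpace ℝ F] {f : E → F} {U : Set E} {p : E} (hU : IsOpen U) (hp : p ∈ U)
    (hf : ContDiffOn ℝ ∞ f U) : ∃ g : E → F, ContDiff ℝ ∞ g ∧ g =ᶠ[𝓝 p] f := by
  obtain ⟨r, hr, hrU⟩ := Metric.isOpen_iff.1 hU p hp
  let b : ContDiffBump p := ⟨r / 4, r / 2, by positivity, by linarith⟩
  refine ⟨fun x => b x • f x, ?_, ?_⟩
  · rw [contDiff_iff_contDiffAt]
    intro x
    by_cases hx : x ∈ U
    · exact b.contDiffAt.smul (hf.contDiffAt (hU.mem_nhds hx))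
    · have hx' : x ∉ tsupport b := fun h => hx (hrU (by
        rw [b.tsupport_eq] at h
        exact Metric.closedBall_subset_ball (by change r / 2 < r; linarith) h))
      have h0 : (fun x => b x • f x) =ᶠ[𝓝 x] fun _ => 0 := by
        filter_upwards [(isClosed_tsupport b).isOpen_compl.mem_nhds hx'] with y hy
        rw [image_eq_zero_of_notMem_tsupport hy, zero_smul]
      exact contDiffAt_const.congr_of_eventuallyEq h0
  · filter_upwards [b.eventuallyEq_one] with x hx
    simp [hx]

variable {H : Type} [NormedAddCommGroup H] [NormedSpace ℝ H] [FiniteDimensional ℝ H]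

/-- **Frobenius theorem** for a one-form `α` with `α ∧ dα = 0` which does not vanish on a given
direction. -/
theorem exists_firstIntegral_of_integrable {α : E → E →L[ℝ] ℝ} {U : Set E} (hU : IsOpen U)
    (hα : ContDiffOn ℝ ∞ α U) (ι : (H × ℝ) ≃L[ℝ] E) {p : E} (hp : p ∈ U)
    (hne : ∀ x ∈ U, α x (ι (0, 1)) ≠ 0)
    (hint : ∀ x ∈ U, ∀ u v, α x u = 0 → α x v = 0 → fderiv ℝ α x u v = fderiv ℝ α x v u) :
    ∃ (V : Set E) (g : E → ℝ), IsOpen V ∧ p ∈ V ∧ V ⊆ U ∧ ContDiffOn ℝ ∞ g V ∧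
      ∀ x ∈ V, ∃ c : ℝ, c ≠ 0 ∧ α x = c • fderiv ℝ g x := by
  have : CompleteSpace H := FiniteDimensional.complete ℝ H
  let T : H × ℝ → E := fun y => p + ι y
  have hT : ContDiff ℝ ∞ T := contDiff_const.add ι.contDiff
  have hTd : ∀ y, HasFDerivAt T (ι : H × ℝ →L[ℝ] E) y := fun y => ι.hasFDerivAt.const_add p
  set U' : Set (H × ℝ) := T ⁻¹' U
  have hU' : IsOpen U' := hU.preimage hT.continuous
  have h0U' : (0 : H × ℝ) ∈ U' := by simpa [U', T] using hp
  have hαT : ContDiffOn ℝ ∞ (fun y => α (T y)) U' := hα.comp hT.contDiffOn fun y hy => hy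
  let inl' : H →L[ℝ] E := (ι : H × ℝ →L[ℝ] E).comp (ContinuousLinearMap.inl ℝ H ℝ)
  -- Dividing by the nonvanishing coefficient `c` of `dz` turns the pullback of `α` into `c (dz -
  -- η₀)`, a graph distribution.
  let c : H × ℝ → ℝ := fun y => α (T y) (ι (0, 1))
  have hc : ContDiffOn ℝ ∞ c U' := hαT.clm_apply contDiffOn_const
  let η₀ : H × ℝ → H →L[ℝ] ℝ := fun y => (-(c y)⁻¹) • (α (T y)).comp inl'
  have hη₀ : ContDiffOn ℝ ∞ η₀ U' :=
    (hc.inv fun y hy => hne _ hy).neg.smul (hαT.clm_comp contDiffOn_const)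
  obtain ⟨η, hη, hηη₀⟩ := exists_contDiff_eventuallyEq hU' h0U' hη₀
  have hαη : ∀ y ∈ U', ∀ v : H × ℝ, α (T y) (ι v) = c y * (v.2 - η₀ y v.1) := by
    intro y hy v
    have hcy : c y ≠ 0 := hne _ hy
    have h1 : α (T y) (ι v) = α (T y) (inl' v.1) + v.2 * c y := by
      conv_lhs => rw [show v = (v.1, 0) + v.2 • ((0 : H), (1 : ℝ)) by ext <;> simp]
      rw [map_add, map_smul, map_add, map_smul, smul_eq_mul]
      rfl
    have h2 : η₀ y v.1 = -(c y)⁻¹ * α (T y) (inl' v.1) := rfl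
    rw [h1, h2]
    field_simp
    ring
  have hint' : ∀ᶠ x in 𝓝 (0 : H × ℝ), ∀ h k : H,
      fderiv ℝ η x (k, η x k) h = fderiv ℝ η x (h, η x h) k := by
    filter_upwards [hηη₀.eventuallyEq_nhds, hU'.mem_nhds h0U'] with y hy hyU
    rw [hy.fderiv_eq, hy.self_of_nhds]
    have hcy : c y ≠ 0 := hne _ hyU
    have hαd : HasFDerivAt (fun y => α (T y)) ((fderiv ℝ α (T y)).comp (ι : H × ℝ →L[ℝ] E)) y :=
      HasFDerivAt.comp (g := α) y
        ((hα.contDiffAt (hU.mem_nhds hyU)).differentiableAt (by simp)).hasFDerivAt (hTd y)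
    have hcd : HasFDerivAt c (fderiv ℝ c y) y :=
      ((hc.contDiffAt (hU'.mem_nhds hyU)).differentiableAt (by simp)).hasFDerivAt
    have hηd : HasFDerivAt η₀ (fderiv ℝ η₀ y) y :=
      ((hη₀.contDiffAt (hU'.mem_nhds hyU)).differentiableAt (by simp)).hasFDerivAt
    -- Obtained by differentiating the identity `α (k, η₀ k) = 0`. It expresses the derivative of
    -- `α` on tangent vectors through that of `η₀`, so the symmetry assumed for `α` on its kernel
    -- becomes the symmetry required of `η₀`.
    have key : ∀ (w : H × ℝ) (k : H),
        fderiv ℝ α (T y) (ι w) (ι (k, η₀ y k)) = -(c y * fderiv ℝ η₀ y w k) := by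
      intro w k
      have h1 : HasFDerivAt (fun y => α (T y) (ι (k, η₀ y k)))
          (((fderiv ℝ α (T y)).comp (ι : H × ℝ →L[ℝ] E)).flip (ι (k, η₀ y k)) +
            (α (T y)).comp ((ι : H × ℝ →L[ℝ] E).comp ((0 : H × ℝ →L[ℝ] H).prod
              ((fderiv ℝ η₀ y).flip k)))) y := by
        have hk : HasFDerivAt (fun y => η₀ y k) ((fderiv ℝ η₀ y).flip k) y := by
          simpa using hηd.clm_apply (hasFDerivAt_const k y)
        have hk2 : HasFDerivAt (fun y => ι (k, η₀ y k)) ((ι : H × ℝ →L[ℝ] E).comp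
            ((0 : H × ℝ →L[ℝ] H).prod ((fderiv ℝ η₀ y).flip k))) y :=
          ι.hasFDerivAt.comp y ((hasFDerivAt_const k y).prodMk hk)
        have := hαd.clm_apply hk2
        rwa [add_comm] at this
      have h2 : (fun y => α (T y) (ι (k, η₀ y k))) =ᶠ[𝓝 y] fun _ => 0 := by
        filter_upwards [hU'.mem_nhds hyU] with z hz
        rw [hαη z hz]
        simp
      have h3 := h1.unique ((hasFDerivAt_const (0 : ℝ) y).congr_of_eventuallyEq h2)
      have h4 := DFunLike.congr_fun h3 w
      have h5 : α (T y) (ι (0, fderiv ℝ η₀ y w k)) = c y * fderiv ℝ η₀ y w k := by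
        rw [hαη y hyU]; simp
      simp only [add_apply, ContinuousLinearMap.flip_apply, ContinuousLinearMap.comp_apply,
        ContinuousLinearMap.prod_apply, zero_apply, ContinuousLinearEquiv.coe_coe, h5] at h4
      linarith
    intro h k
    have h6 := hint _ hyU (ι (k, η₀ y k)) (ι (h, η₀ y h)) (by rw [hαη y hyU]; simp)
      (by rw [hαη y hyU]; simp)
    rw [key, key] at h6
    exact mul_left_cancel₀ hcy (neg_injective h6)
  obtain ⟨V, g, hV, h0V, hg, hgd⟩ := exists_firstIntegral_of_integrable_graph hη hint'
  obtain ⟨V₁, hV₁, hV₁o, h0V₁⟩ := eventually_nhds_iff.1 hηη₀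
  let S : E → H × ℝ := fun x => ι.symm (x - p)
  have hS : ContDiff ℝ ∞ S := ι.symm.contDiff.comp (contDiff_id.sub contDiff_const)
  have hTS : ∀ x, T (S x) = x := fun x => by simp [T, S]
  have hSp : S p = 0 := by simp [S]
  refine ⟨S ⁻¹' (V ∩ V₁) ∩ U, fun x => g (S x), ((hV.inter hV₁o).preimage hS.continuous).inter hU,
    ⟨?_, hp⟩, Set.inter_subset_right, ?_, ?_⟩
  · rw [Set.mem_preimage, hSp]; exact ⟨h0V, h0V₁⟩
  · exact hg.comp hS.contDiffOn fun x hx => hx.1.1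
  · rintro x ⟨⟨hxV, hxV₁⟩, hxU⟩
    obtain ⟨d, hd0, hd⟩ := hgd _ hxV
    have hSd : HasFDerivAt S (ι.symm : E →L[ℝ] H × ℝ) x :=
      ι.symm.hasFDerivAt.comp x ((hasFDerivAt_id x).sub_const p)
    have hgS : HasFDerivAt (fun x => g (S x)) ((fderiv ℝ g (S x)).comp (ι.symm : E →L[ℝ] H × ℝ)) x :=
      HasFDerivAt.comp (g := g) x
        ((hg.contDiffAt (hV.mem_nhds hxV)).differentiableAt (by simp)).hasFDerivAt hSd
    have hSU : S x ∈ U' := by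
      change T (S x) ∈ U
      rwa [hTS]
    refine ⟨c (S x) * d, mul_ne_zero (hne _ hSU) hd0, ?_⟩
    rw [hgS.fderiv]
    refine ContinuousLinearMap.ext fun v => ?_
    have h1 := hαη _ hSU (ι.symm v)
    rw [hTS, ι.apply_symm_apply, ← hV₁ _ hxV₁, hd] at h1
    rw [h1]
    simp [mul_assoc]

end Frobenius

/-! ### Calculus in `ℝ³` -/

section Calculus

theorem dcoord_apply (i : Fin 3) (v : R3) : dcoord i v = v i := rfl

theorem dcoord_single (i j : Fin 3) : dcoord i (EuclideanSpace.single j 1) = if i = j then 1 else 0 := by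
  rw [dcoord_apply, PiLp.single_apply]

theorem eq_sum_single (v : R3) : v = v 0 • EuclideanSpace.single 0 (1 : ℝ) +
    v 1 • EuclideanSpace.single 1 (1 : ℝ) + v 2 • EuclideanSpace.single 2 (1 : ℝ) := by
  ext i
  fin_cases i <;> simp

theorem clm_eq_sum_dcoord (a : R3 →L[ℝ] ℝ) :
    a = a (EuclideanSpace.single 0 1) • dcoord 0 + a (EuclideanSpace.single 1 1) • dcoord 1 +
      a (EuclideanSpace.single 2 1) • dcoord 2 := by
  refine ContinuousLinearMap.ext fun v => ?_
  conv_lhs => rw [eq_sum_single v]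
  simp only [map_add, map_smul, add_apply, smul_apply, smul_eq_mul, dcoord_apply]
  ring

theorem fderiv_apply_eq_sum_pd (f : R3 → ℝ) (x v : R3) :
    fderiv ℝ f x v = pd 0 f x * v 0 + pd 1 f x * v 1 + pd 2 f x * v 2 := by
  conv_lhs => rw [clm_eq_sum_dcoord (fderiv ℝ f x)]
  rfl

theorem contDiffOn_pd {f : R3 → ℝ} {U : Set R3} (hU : IsOpen U) (hf : ContDiffOn ℝ ∞ f U)
    (i : Fin 3) : ContDiffOn ℝ ∞ (pd i f) U :=
  (hf.fderiv_of_isOpen hU (m := ∞) (by simp)).clm_apply contDiffOn_const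

theorem pd_pd_apply {f : R3 → ℝ} {U : Set R3} (hU : IsOpen U) (hf : ContDiffOn ℝ ∞ f U)
    (i j : Fin 3) {x : R3} (hx : x ∈ U) :
    pd i (pd j f) x =
      fderiv ℝ (fderiv ℝ f) x (EuclideanSpace.single i 1) (EuclideanSpace.single j 1) := by
  have h : DifferentiableAt ℝ (fderiv ℝ f) x :=
    ((hf.fderiv_of_isOpen hU (m := ∞) (by simp)).contDiffAt (hU.mem_nhds hx)).differentiableAt
      (by simp)
  have h1 := h.hasFDerivAt.clm_apply (hasFDerivAt_const (EuclideanSpace.single j (1 : ℝ)) x)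
  change fderiv ℝ (fun y => fderiv ℝ f y (EuclideanSpace.single j 1)) x _ = _
  rw [h1.fderiv]
  simp

theorem pd_comm {f : R3 → ℝ} {U : Set R3} (hU : IsOpen U) (hf : ContDiffOn ℝ ∞ f U)
    (i j : Fin 3) {x : R3} (hx : x ∈ U) : pd i (pd j f) x = pd j (pd i f) x := by
  rw [pd_pd_apply hU hf i j hx, pd_pd_apply hU hf j i hx]
  exact (hf.contDiffAt (hU.mem_nhds hx)).isSymmSndFDerivAt
    (by simpa using (ENat.LEInfty.out : (2 : ℕ∞ω) ≤ ∞)) _ _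

theorem hasFDerivAt_pd {f : R3 → ℝ} {U : Set R3} (hU : IsOpen U) (hf : ContDiffOn ℝ ∞ f U)
    (i : Fin 3) {x : R3} (hx : x ∈ U) : HasFDerivAt (pd i f) (fderiv ℝ (pd i f) x) x :=
  (((contDiffOn_pd hU hf i).contDiffAt (hU.mem_nhds hx)).differentiableAt (by simp)).hasFDerivAt

end Calculus

/-! ### The one-forms `α^s` and the Hirota equation -/

section Hirota

variable {l : Fin 3 → ℝ} {f : R3 → ℝ}

theorem hirotaForm_coe_apply (l : Fin 3 → ℝ) (f : R3 → ℝ) (t : ℝ) (x v : R3) :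
    hirotaForm l f (t : OnePoint ℝ) x v = (l 1 - t) * (l 2 - t) * pd 0 f x * v 0 +
      (l 2 - t) * (l 0 - t) * pd 1 f x * v 1 + (l 0 - t) * (l 1 - t) * pd 2 f x * v 2 := rfl

theorem hirotaForm_coe (l : Fin 3 → ℝ) (f : R3 → ℝ) (t : ℝ) (x : R3) :
    hirotaForm l f (t : OnePoint ℝ) x = ((l 1 - t) * (l 2 - t) * pd 0 f x) • dcoord 0 +
      ((l 2 - t) * (l 0 - t) * pd 1 f x) • dcoord 1 +
      ((l 0 - t) * (l 1 - t) * pd 2 f x) • dcoord 2 := rfl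

theorem hirotaForm_infty (l : Fin 3 → ℝ) (f : R3 → ℝ) (x : R3) :
    hirotaForm l f OnePoint.infty x = fderiv ℝ f x :=
  (clm_eq_sum_dcoord (fderiv ℝ f x)).symm

theorem hirotaForm_node (l : Fin 3 → ℝ) (f : R3 → ℝ) (i : Fin 3) (x : R3) :
    hirotaForm l f (l i : OnePoint ℝ) x =
      ((l (i + 1) - l i) * (l (i + 2) - l i) * pd i f x) • dcoord i := by
  refine ContinuousLinearMap.ext fun v => ?_
  rw [hirotaForm_coe_apply, smul_apply, dcoord_apply, smul_eq_mul]
  fin_cases i <;> simp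

theorem hirotaForm_node_coeff_ne_zero (hl : Function.Injective l) {x : R3}
    (hf : ∀ i, pd i f x ≠ 0) (i : Fin 3) :
    (l (i + 1) - l i) * (l (i + 2) - l i) * pd i f x ≠ 0 := by
  refine mul_ne_zero (mul_ne_zero ?_ ?_) (hf i) <;> rw [sub_ne_zero, hl.ne_iff] <;> fin_cases i <;> decide

theorem ker_hirotaForm_node (hl : Function.Injective l) {x : R3} (hf : ∀ i, pd i f x ≠ 0)
    (i : Fin 3) :
    LinearMap.ker (hirotaForm l f (l i : OnePoint ℝ) x).toLinearMap =
      LinearMap.ker (dcoord i).toLinearMap := by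
  rw [hirotaForm_node]
  exact LinearMap.ker_smul _ _ (hirotaForm_node_coeff_ne_zero hl hf i)

/-- The form `α^t` satisfies `α ∧ dα = 0` if `f` solves the Hirota equation. -/
theorem fderiv_hirotaForm_symm {U : Set R3} (hU : IsOpen U) (h : IsHirotaSolutionOn l f U)
    {t : ℝ} (ht : ∀ i, l i ≠ t) {x : R3} (hx : x ∈ U) (u v : R3)
    (hu : hirotaForm l f (t : OnePoint ℝ) x u = 0) (hv : hirotaForm l f (t : OnePoint ℝ) x v = 0) :
    fderiv ℝ (hirotaForm l f (t : OnePoint ℝ)) x u v =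
      fderiv ℝ (hirotaForm l f (t : OnePoint ℝ)) x v u := by
  have hd := fun i => hasFDerivAt_pd hU h.smooth i hx
  have hα : HasFDerivAt (hirotaForm l f (t : OnePoint ℝ)) _ x :=
    ((((hd 0).const_mul ((l 1 - t) * (l 2 - t))).smul_const (dcoord 0)).add
      (((hd 1).const_mul ((l 2 - t) * (l 0 - t))).smul_const (dcoord 1))).add
      (((hd 2).const_mul ((l 0 - t) * (l 1 - t))).smul_const (dcoord 2))
  rw [hα.fderiv]
  simp only [add_apply, smul_apply, ContinuousLinearMap.smulRight_apply, smul_eq_mul, dcoord_apply,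
    fderiv_apply_eq_sum_pd]
  have h01 := pd_comm hU h.smooth 0 1 hx
  have h02 := pd_comm hU h.smooth 0 2 hx
  have h12 := pd_comm hU h.smooth 1 2 hx
  have heq := h.equation x hx
  rw [← h02] at heq
  rw [← h01, ← h02, ← h12]
  rw [hirotaForm_coe_apply] at hu hv
  have hne : (l 0 - t) * (l 1 - t) * pd 2 f x ≠ 0 :=
    mul_ne_zero (mul_ne_zero (sub_ne_zero.2 (ht 0)) (sub_ne_zero.2 (ht 1))) (h.pd_ne_zero x hx 2)
  generalize pd 0 (pd 1 f) x = f01 at *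
  generalize pd 0 (pd 2 f) x = f02 at *
  generalize pd 1 (pd 2 f) x = f12 at *
  generalize pd 0 f x = f0 at *
  generalize pd 1 f x = f1 at *
  generalize pd 2 f x = f2 at *
  -- Since `u` and `v` lie in the kernel of `α^t`, their cross product is proportional to its
  -- coefficient vector. This turns `dα (u, v)` into a multiple of `α ∧ dα`, that is, of the Hirota
  -- expression.
  have c0 : ((l 0 - t) * (l 1 - t) * f2) * (u 1 * v 2 - u 2 * v 1) =
      ((l 1 - t) * (l 2 - t) * f0) * (u 0 * v 1 - u 1 * v 0) := by
    linear_combination u 1 * hv - v 1 * hu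
  have c1 : ((l 0 - t) * (l 1 - t) * f2) * (u 2 * v 0 - u 0 * v 2) =
      ((l 2 - t) * (l 0 - t) * f1) * (u 0 * v 1 - u 1 * v 0) := by
    linear_combination v 0 * hu - u 0 * hv
  rw [← sub_eq_zero]
  refine (mul_eq_zero_iff_left hne).1 ?_
  linear_combination f12 * (l 0 - t) * (l 1 - l 2) * c0 + f02 * (l 1 - t) * (l 2 - l 0) * c1 +
    (l 0 - t) * (l 1 - t) * (l 2 - t) * (u 0 * v 1 - u 1 * v 0) * heq

theorem exists_eq_smul_of_ker_eq {E : Type*} [AddCommGroup E] [Module ℝ E] [TopologicalSpace E]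
    {a b : E →L[ℝ] ℝ} (hb : b ≠ 0)
    (h : LinearMap.ker a.toLinearMap = LinearMap.ker b.toLinearMap) :
    ∃ c : ℝ, c ≠ 0 ∧ a = c • b := by
  obtain ⟨v, hv⟩ : ∃ v, b v ≠ 0 := by
    by_contra! hcon
    exact hb (ContinuousLinearMap.ext hcon)
  have hav : a v ≠ 0 := fun h0 => hv (by
    have : v ∈ LinearMap.ker b.toLinearMap := by rw [← h]; exact h0
    exact this)
  refine ⟨a v / b v, div_ne_zero hav hv, ContinuousLinearMap.ext fun w => ?_⟩
  have hw : w - (b w / b v) • v ∈ LinearMap.ker a.toLinearMap := by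
    rw [h, LinearMap.mem_ker]
    simp [hv]
  rw [LinearMap.mem_ker] at hw
  simp only [ContinuousLinearMap.coe_coe, map_sub, map_smul, smul_eq_mul, sub_eq_zero] at hw
  rw [hw, smul_apply, smul_eq_mul]
  field_simp

/-- If the form `α^t` is proportional to `dg`, then `f` solves the Hirota equation. -/
theorem hirota_equation_of_ker_eq {U : Set R3} (hU : IsOpen U) (hf : ContDiffOn ℝ ∞ f U)
    {g : R3 → ℝ} (hg : ContDiffOn ℝ ∞ g U) {t : ℝ} (ht : ∀ i, l i ≠ t)
    (hgne : ∀ x ∈ U, fderiv ℝ g x ≠ 0)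
    (hker : ∀ x ∈ U, LinearMap.ker (hirotaForm l f (t : OnePoint ℝ) x).toLinearMap =
      LinearMap.ker (fderiv ℝ g x).toLinearMap) {x : R3} (hx : x ∈ U) :
    (l 1 - l 2) * pd 0 f x * pd 1 (pd 2 f) x
      + (l 2 - l 0) * pd 1 f x * pd 2 (pd 0 f) x
      + (l 0 - l 1) * pd 2 f x * pd 0 (pd 1 f) x = 0 := by
  have hgi : ∀ y ∈ U, ∃ c : ℝ, fderiv ℝ g y = c • hirotaForm l f (t : OnePoint ℝ) y := by
    intro y hy
    have h0 : hirotaForm l f (t : OnePoint ℝ) y ≠ 0 := by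
      intro h0
      have h1 := hker y hy
      rw [h0] at h1
      exact hgne y hy (ContinuousLinearMap.ext fun v => by
        have : v ∈ LinearMap.ker (fderiv ℝ g y).toLinearMap := by rw [← h1]; simp
        exact this)
    obtain ⟨c, -, hc⟩ := exists_eq_smul_of_ker_eq h0 (hker y hy).symm
    exact ⟨c, hc⟩
  have hpd : ∀ y ∈ U, ∃ c : ℝ, pd 0 g y = c * ((l 1 - t) * (l 2 - t) * pd 0 f y) ∧
      pd 1 g y = c * ((l 2 - t) * (l 0 - t) * pd 1 f y) ∧
      pd 2 g y = c * ((l 0 - t) * (l 1 - t) * pd 2 f y) := by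
    intro y hy
    obtain ⟨c, hc⟩ := hgi y hy
    refine ⟨c, ?_, ?_, ?_⟩ <;> simp [pd, hc, hirotaForm_coe_apply]
  have hdf := fun i => hasFDerivAt_pd hU hf i hx
  have hdg := fun i => hasFDerivAt_pd hU hg i hx
  -- Proportionality of `dg` and `α^t` is differentiated in its cross-multiplied form, so that no
  -- regularity of the factor `c` is needed.
  have hcross : ∀ (a b : ℝ) (i j k : Fin 3),
      (∀ y ∈ U, a * (pd i f y * pd j g y) = b * (pd j f y * pd i g y)) →
      a * (pd i f x * pd k (pd j g) x + pd j g x * pd k (pd i f) x) =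
        b * (pd j f x * pd k (pd i g) x + pd i g x * pd k (pd j f) x) := by
    intro a b i j k h
    have h1 := ((hdf i).mul (hdg j)).const_mul a
    have h2 := ((hdf j).mul (hdg i)).const_mul b
    have h3 := h1.unique (h2.congr_of_eventuallyEq (by
      filter_upwards [hU.mem_nhds hx] with y hy
      exact h y hy))
    exact DFunLike.congr_fun h3 (EuclideanSpace.single k 1)
  have e01 := hcross ((l 1 - t) * (l 2 - t)) ((l 2 - t) * (l 0 - t)) 0 1 2 (fun y hy => by
    obtain ⟨c, h0, h1, h2⟩ := hpd y hy
    rw [h0, h1]; ring)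
  have e12 := hcross ((l 2 - t) * (l 0 - t)) ((l 0 - t) * (l 1 - t)) 1 2 0 (fun y hy => by
    obtain ⟨c, h0, h1, h2⟩ := hpd y hy
    rw [h1, h2]; ring)
  have e20 := hcross ((l 0 - t) * (l 1 - t)) ((l 1 - t) * (l 2 - t)) 2 0 1 (fun y hy => by
    obtain ⟨c, h0, h1, h2⟩ := hpd y hy
    rw [h2, h0]; ring)
  obtain ⟨c, h0, h1, h2⟩ := hpd x hx
  have hc : c ≠ 0 := by
    rintro rfl
    refine hgne x hx ?_
    rw [clm_eq_sum_dcoord (fderiv ℝ g x)]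
    simp only [zero_mul] at h0 h1 h2
    simp only [pd] at h0 h1 h2
    simp [h0, h1, h2]
  rw [pd_comm hU hg 2 1 hx, pd_comm hU hf 2 1 hx] at e01
  rw [pd_comm hU hg 0 2 hx] at e12
  rw [pd_comm hU hg 1 0 hx, pd_comm hU hf 1 0 hx] at e20
  rw [pd_comm hU hf 0 2 hx] at e12
  rw [h0, h1] at e01
  rw [h1, h2] at e12
  rw [h2, h0] at e20
  have hne : c * ((l 0 - t) * (l 1 - t) * (l 2 - t)) ≠ 0 :=
    mul_ne_zero hc (mul_ne_zero (mul_ne_zero (sub_ne_zero.2 (ht 0)) (sub_ne_zero.2 (ht 1)))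
      (sub_ne_zero.2 (ht 2)))
  refine (mul_eq_zero_iff_left hne).1 ?_
  -- In the cyclic sum the second derivatives of `g` cancel; what remains is `c * ∏ (l i - t)` times
  -- the Hirota expression.
  linear_combination e01 + e12 + e20

end Hirota

/-! ### The Veronese web of a solution -/

/-- The tangent trivialisations of the model space are identities, so the form read in the bundle
coordinates is the form itself. -/
theorem OneForm.smoothOn_of_contDiffOn {α : OneForm R3} {U : Set R3}
    (h : ContDiffOn ℝ ∞ (F := R3 →L[ℝ] ℝ) α U) : OneForm.SmoothOn (M := R3) α U := by
  intro x hx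
  rw [contMDiffWithinAt_hom_bundle]
  refine ⟨contMDiffWithinAt_id, (h x hx).contMDiffWithinAt.congr (fun y _ => ?_) ?_⟩ <;>
  · simp only [ContinuousLinearMap.inCoordinates]
    rw [TangentBundle.symmL_model_space]
    ext v
    simp
    rfl

theorem isFirstIntegralOn_iff_fderiv {D : TangentField R3} {g : R3 → ℝ} {V : Set R3} :
    IsFirstIntegralOn D g V ↔ ContDiffOn ℝ ∞ g V ∧
      ∀ x ∈ V, fderiv ℝ g x ≠ 0 ∧ D x = LinearMap.ker (fderiv ℝ g x).toLinearMap := by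
  rw [IsFirstIntegralOn, contMDiffOn_iff_contDiffOn]
  refine and_congr_right fun _ => forall₂_congr fun x _ => ?_
  rw [mfderiv_eq_fderiv]
  rfl

section Hirota

variable {l : Fin 3 → ℝ} {f : R3 → ℝ} {U : Set R3}

theorem isFirstIntegralOn_coord_hirotaWeb (hl : Function.Injective l)
    (hf : ∀ x ∈ U, ∀ i, pd i f x ≠ 0) :
    HasCoordinateFoliationsOn l (hirotaWeb l f) (fun x => x) U := by
  intro i
  refine isFirstIntegralOn_iff_fderiv.2 ⟨(dcoord i).contDiff.contDiffOn, fun x hx => ?_⟩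
  have h1 : fderiv ℝ (fun q : R3 => q i) x = dcoord i := (dcoord i).hasFDerivAt.fderiv
  rw [h1]
  refine ⟨fun h0 => ?_, ker_hirotaForm_node hl (hf x hx) i⟩
  have := DFunLike.congr_fun h0 (EuclideanSpace.single i 1)
  simp [dcoord_single] at this

theorem isFirstIntegralOn_infty_hirotaWeb (h : IsHirotaSolutionOn l f U) :
    IsFirstIntegralOn (hirotaWeb l f OnePoint.infty) f U := by
  refine isFirstIntegralOn_iff_fderiv.2 ⟨h.smooth, fun x hx => ⟨fun h0 => ?_, ?_⟩⟩
  · exact h.pd_ne_zero x hx 0 (by rw [pd, h0]; rfl)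
  · rw [hirotaWeb, hirotaForm_infty]; rfl

/-- The first two coordinates and the third one. -/
def r3Equiv : ((ℝ × ℝ) × ℝ) ≃L[ℝ] R3 :=
  LinearEquiv.toContinuousLinearEquiv
    { toFun := fun y => !₂[y.1.1, y.1.2, y.2]
      invFun := fun x => ((x 0, x 1), x 2)
      map_add' := fun x y => by ext i; fin_cases i <;> simp
      map_smul' := fun c x => by ext i; fin_cases i <;> simp
      left_inv := fun y => by simp
      right_inv := fun x => by ext i; fin_cases i <;> simp }

theorem r3Equiv_zero_one : r3Equiv (0, 1) = EuclideanSpace.single 2 (1 : ℝ) := by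
  ext i
  fin_cases i <;> simp [r3Equiv]

theorem contDiffOn_combination {a : Fin 3 → ℝ} (hU : IsOpen U) (hf : ContDiffOn ℝ ∞ f U) :
    ContDiffOn ℝ ∞ (fun x => (a 0 * pd 0 f x) • dcoord 0 + (a 1 * pd 1 f x) • dcoord 1 +
      (a 2 * pd 2 f x) • dcoord 2) U := by
  have h := fun i => contDiffOn_const (c := a i).mul (contDiffOn_pd hU hf i)
  exact (((h 0).smul contDiffOn_const).add ((h 1).smul contDiffOn_const)).add
    ((h 2).smul contDiffOn_const)

/-- For every `t` which is not one of the nodes, `α^t` has local first integrals. -/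
theorem exists_isFirstIntegralOn_hirotaWeb (hU : IsOpen U) (h : IsHirotaSolutionOn l f U) {t : ℝ}
    (ht : ∀ i, l i ≠ t) {p : R3} (hp : p ∈ U) :
    ∃ (V : Set R3) (g : R3 → ℝ), IsOpen V ∧ p ∈ V ∧ V ⊆ U ∧
      IsFirstIntegralOn (hirotaWeb l f (t : OnePoint ℝ)) g V := by
  have hne : ∀ x ∈ U, hirotaForm l f (t : OnePoint ℝ) x (r3Equiv (0, 1)) ≠ 0 := by
    intro x hx
    rw [r3Equiv_zero_one, hirotaForm_coe_apply]
    simpa using ⟨⟨sub_ne_zero.2 (ht 0), sub_ne_zero.2 (ht 1)⟩, h.pd_ne_zero x hx 2⟩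
  have hsm : ContDiffOn ℝ ∞ (hirotaForm l f (t : OnePoint ℝ)) U :=
    contDiffOn_combination (a := ![(l 1 - t) * (l 2 - t), (l 2 - t) * (l 0 - t),
      (l 0 - t) * (l 1 - t)]) hU h.smooth
  obtain ⟨V, g, hV, hpV, hVU, hg, hgd⟩ := exists_firstIntegral_of_integrable hU hsm r3Equiv hp hne
    (fun x hx u v hu hv => fderiv_hirotaForm_symm hU h ht hx u v hu hv)
  refine ⟨V, g, hV, hpV, hVU, isFirstIntegralOn_iff_fderiv.2 ⟨hg, fun x hx => ?_⟩⟩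
  obtain ⟨c, hc, hcx⟩ := hgd x hx
  refine ⟨fun h0 => hne x (hVU hx) ?_, ?_⟩
  · rw [hcx, h0]; simp
  · rw [hirotaWeb, hcx]
    exact LinearMap.ker_smul _ _ hc

/-- Only the values off the nodes need the Frobenius theorem; at `∞` and at `l i` the first
integrals are `f` and the coordinates. -/
theorem isVeroneseWebOn_hirotaWeb (hl : Function.Injective l) (hU : IsOpen U)
    (h : IsHirotaSolutionOn l f U) : IsVeroneseWebOn (M := R3) (hirotaWeb l f) U := by
  refine ⟨fun s p hp => ?_, fun p hp => ⟨U, hU, hp, subset_rfl, ?_⟩⟩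
  · induction s using OnePoint.rec with
    | infty => exact ⟨U, hU, hp, subset_rfl, f, isFirstIntegralOn_infty_hirotaWeb h⟩
    | coe t =>
      by_cases ht : ∀ i, l i ≠ t
      · obtain ⟨V, g, hV, hpV, hVU, hg⟩ := exists_isFirstIntegralOn_hirotaWeb hU h ht hp
        exact ⟨V, hV, hpV, hVU, g, hg⟩
      · push Not at ht
        obtain ⟨i, rfl⟩ := ht
        exact ⟨U, hU, hp, subset_rfl, _, isFirstIntegralOn_coord_hirotaWeb hl h.pd_ne_zero i⟩
  -- Row `k` holds the coefficients of `t ^ k` in `(l 1 - t) * (l 2 - t)` and its cyclic shifts. The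
  -- rows are independent because the nodes are distinct.
  · let c : Fin 3 → Fin 3 → ℝ := ![![l 1 * l 2, l 2 * l 0, l 0 * l 1],
      ![-(l 1 + l 2), -(l 2 + l 0), -(l 0 + l 1)], ![1, 1, 1]]
    let α : Fin 3 → R3 → R3 →L[ℝ] ℝ := fun k x => (c k 0 * pd 0 f x) • dcoord 0 +
      (c k 1 * pd 1 f x) • dcoord 1 + (c k 2 * pd 2 f x) • dcoord 2
    refine ⟨α, fun k => OneForm.smoothOn_of_contDiffOn (contDiffOn_combination hU h.smooth),
      fun x hx => ⟨?_, fun s => ?_⟩⟩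
    · change LinearIndependent ℝ (fun k => α k x)
      rw [Fintype.linearIndependent_iff]
      intro b hb
      have hi : ∀ i, (b 0 * c 0 i + b 1 * c 1 i + b 2 * c 2 i) * pd i f x = 0 := by
        intro i
        have h1 := DFunLike.congr_fun hb (EuclideanSpace.single i (1 : ℝ))
        rw [Fin.sum_univ_three] at h1
        simp only [α, add_apply, smul_apply, dcoord_single, zero_apply] at h1
        fin_cases i <;> simp [-mul_eq_zero] at h1 ⊢ <;> linear_combination h1
      have hi' := fun i => (mul_eq_zero.1 (hi i)).resolve_right (h.pd_ne_zero x hx i)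
      have h0 := hi' 0
      have h1 := hi' 1
      have h2 := hi' 2
      simp only [c, Matrix.cons_val_zero, Matrix.cons_val_one, Matrix.cons_val] at h0 h1 h2
      have l01 : l 0 - l 1 ≠ 0 := sub_ne_zero.2 (hl.ne (by decide))
      have l12 : l 1 - l 2 ≠ 0 := sub_ne_zero.2 (hl.ne (by decide))
      have l20 : l 2 - l 0 ≠ 0 := sub_ne_zero.2 (hl.ne (by decide))
      have e1 : b 0 * l 2 - b 1 = 0 := (mul_eq_zero_iff_left l01).1 (by linear_combination h1 - h0)
      have e2 : b 0 * l 0 - b 1 = 0 := (mul_eq_zero_iff_left l12).1 (by linear_combination h2 - h1)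
      have b0 : b 0 = 0 := (mul_eq_zero_iff_left l20).1 (by linear_combination e1 - e2)
      have b1 : b 1 = 0 := by rw [b0] at e1; linarith
      have b2 : b 2 = 0 := by rw [b0, b1] at h0; linarith
      intro i
      fin_cases i <;> assumption
    · have hs : hirotaForm l f s x = veroneseCurve (fun k => α k x) s := by
        induction s using OnePoint.rec with
        | infty =>
          change _ = α 2 x
          simp [hirotaForm, α, c]
        | coe t =>
          change _ = α 0 x + t • α 1 x + t ^ 2 • α 2 x
          rw [hirotaForm_coe]
          refine ContinuousLinearMap.ext fun v => ?_
          simp only [α, c, add_apply, smul_apply, smul_eq_mul, Matrix.cons_val_zero,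
            Matrix.cons_val_one, Matrix.cons_val]
          ring
      rw [hirotaWeb, hs]
      rfl

end Hirota

/-! ### Linear algebra of Veronese curves -/

section LinearAlgebra

variable {E : Type*} [AddCommGroup E] [Module ℝ E] [TopologicalSpace E]
  {l : Fin 3 → ℝ} {α ξ : Fin 3 → E →L[ℝ] ℝ} {η : E →L[ℝ] ℝ}

theorem veroneseCurve_ne_zero (hα : LinearIndependent ℝ α) (s : OnePoint ℝ) :
    veroneseCurve α s ≠ 0 := by
  induction s using OnePoint.rec with
  | infty => exact hα.ne_zero 2
  | coe t =>
    intro h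
    have h1 := Fintype.linearIndependent_iff.1 hα ![1, t, t ^ 2] (by
      rw [Fin.sum_univ_three]
      simp only [Matrix.cons_val_zero, Matrix.cons_val_one, Matrix.cons_val, one_smul]
      exact h) 0
    simp at h1

theorem lagrange_denominator_ne_zero (hl : Function.Injective l) (i : Fin 3) :
    (l (i + 1) - l i) * (l (i + 2) - l i) ≠ 0 := by
  refine mul_ne_zero ?_ ?_ <;> rw [sub_ne_zero, hl.ne_iff] <;> fin_cases i <;> decide

theorem veroneseCurve_coe_apply (α : Fin 3 → E →L[ℝ] ℝ) (t : ℝ) (v : E) :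
    veroneseCurve α (t : OnePoint ℝ) v = α 0 v + t * α 1 v + t ^ 2 * α 2 v := rfl

/-- Functionals defining a Veronese family of planes at three distinct nodes are independent. -/
theorem linearIndependent_of_ker_veroneseCurve (hl : Function.Injective l)
    (hα : LinearIndependent ℝ α)
    (hξ : ∀ i, LinearMap.ker (veroneseCurve α (l i : OnePoint ℝ)).toLinearMap =
      LinearMap.ker (ξ i).toLinearMap) : LinearIndependent ℝ ξ := by
  have hk := fun i => exists_eq_smul_of_ker_eq (veroneseCurve_ne_zero hα (l i)) (hξ i).symm
  choose k hk0 hk using hk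
  rw [Fintype.linearIndependent_iff] at hα ⊢
  intro b hb
  have h := hα ![b 0 * k 0 + b 1 * k 1 + b 2 * k 2,
      b 0 * k 0 * l 0 + b 1 * k 1 * l 1 + b 2 * k 2 * l 2,
      b 0 * k 0 * l 0 ^ 2 + b 1 * k 1 * l 1 ^ 2 + b 2 * k 2 * l 2 ^ 2] (by
    refine ContinuousLinearMap.ext fun v => ?_
    have hv := DFunLike.congr_fun hb v
    rw [Fin.sum_univ_three] at hv ⊢
    simp only [hk, add_apply, smul_apply, smul_eq_mul, veroneseCurve_coe_apply, zero_apply] at hv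
    simp only [add_apply, smul_apply, smul_eq_mul, zero_apply, Matrix.cons_val_zero,
      Matrix.cons_val_one, Matrix.cons_val]
    linear_combination hv)
  have h0 := h 0
  have h1 := h 1
  have h2 := h 2
  simp only [Matrix.cons_val_zero, Matrix.cons_val_one, Matrix.cons_val] at h0 h1 h2
  have d := lagrange_denominator_ne_zero hl
  have d0 := d 0
  have d1 := d 1
  have d2 := d 2
  simp only [Fin.isValue, zero_add, show (1 : Fin 3) + 1 = 2 from rfl,
    show (1 : Fin 3) + 2 = 0 from rfl, show (2 : Fin 3) + 1 = 0 from rfl,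
    show (2 : Fin 3) + 2 = 1 from rfl] at d0 d1 d2
  -- Weighting the three moment equations by the coefficients of `(X - l 1) * (X - l 2)` removes the
  -- other two unknowns; likewise for `b 1` and `b 2`.
  have b0 : b 0 = 0 := (mul_eq_zero_iff_left (mul_ne_zero d0 (hk0 0))).1
    (by linear_combination h2 - (l 1 + l 2) * h1 + l 1 * l 2 * h0)
  have b1 : b 1 = 0 := (mul_eq_zero_iff_left (mul_ne_zero d1 (hk0 1))).1
    (by linear_combination h2 - (l 2 + l 0) * h1 + l 2 * l 0 * h0)
  have b2 : b 2 = 0 := (mul_eq_zero_iff_left (mul_ne_zero d2 (hk0 2))).1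
    (by linear_combination h2 - (l 0 + l 1) * h1 + l 0 * l 1 * h0)
  intro i
  fin_cases i <;> assumption

/-- A Veronese family of planes is determined by its members at three distinct nodes and at
infinity, by Lagrange interpolation. -/
theorem exists_ker_veroneseCurve_eq (hl : Function.Injective l)
    (hα : LinearIndependent ℝ α) (hξ0 : ∀ i, ξ i ≠ 0)
    (hξ : ∀ i, LinearMap.ker (veroneseCurve α (l i : OnePoint ℝ)).toLinearMap =
      LinearMap.ker (ξ i).toLinearMap)
    (hη : LinearMap.ker (veroneseCurve α OnePoint.infty).toLinearMap =
      LinearMap.ker η.toLinearMap) :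
    ∃ c : Fin 3 → ℝ, (∀ i, c i ≠ 0) ∧ η = c 0 • ξ 0 + c 1 • ξ 1 + c 2 • ξ 2 ∧
      ∀ t : ℝ, LinearMap.ker (veroneseCurve α (t : OnePoint ℝ)).toLinearMap =
        LinearMap.ker (((l 1 - t) * (l 2 - t) * c 0) • ξ 0 + ((l 2 - t) * (l 0 - t) * c 1) • ξ 1 +
          ((l 0 - t) * (l 1 - t) * c 2) • ξ 2).toLinearMap := by
  have hk := fun i => exists_eq_smul_of_ker_eq (hξ0 i) (hξ i)
  choose k hk0 hk using hk
  obtain ⟨m, hm0, hm⟩ := exists_eq_smul_of_ker_eq (veroneseCurve_ne_zero hα _) hη.symm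
  have d := lagrange_denominator_ne_zero hl
  have d0 := d 0
  have d1 := d 1
  have d2 := d 2
  simp only [Fin.isValue, zero_add, show (1 : Fin 3) + 1 = 2 from rfl,
    show (1 : Fin 3) + 2 = 0 from rfl, show (2 : Fin 3) + 1 = 0 from rfl,
    show (2 : Fin 3) + 2 = 1 from rfl] at d0 d1 d2
  have hkv : ∀ i v, α 0 v + l i * α 1 v + l i ^ 2 * α 2 v = k i * ξ i v := fun i v => by
    rw [← veroneseCurve_coe_apply, hk]; rfl
  have h10 := left_ne_zero_of_mul d0
  have h20 := right_ne_zero_of_mul d0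
  have h21 := left_ne_zero_of_mul d1
  have h01 := right_ne_zero_of_mul d1
  have h02 := left_ne_zero_of_mul d2
  have h12 := right_ne_zero_of_mul d2
  have hX : ∀ i v, ξ i v = (α 0 v + l i * α 1 v + l i ^ 2 * α 2 v) / k i := fun i v => by
    rw [hkv, mul_div_cancel_left₀ _ (hk0 i)]
  have hk00 := hk0 0
  have hk01 := hk0 1
  have hk02 := hk0 2
  -- The curve takes the value `k i • ξ i` at `l i`, and `η` is `m` times its leading coefficient.
  -- These are the Lagrange weights for the curve scaled by `m`.
  refine ⟨![m * k 0 / ((l 1 - l 0) * (l 2 - l 0)), m * k 1 / ((l 2 - l 1) * (l 0 - l 1)),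
    m * k 2 / ((l 0 - l 2) * (l 1 - l 2))], ?_, ?_, fun t => ?_⟩
  · intro i
    fin_cases i
    · exact div_ne_zero (mul_ne_zero hm0 (hk0 0)) d0
    · exact div_ne_zero (mul_ne_zero hm0 (hk0 1)) d1
    · exact div_ne_zero (mul_ne_zero hm0 (hk0 2)) d2
  · refine ContinuousLinearMap.ext fun v => ?_
    have hmv : η v = m * α 2 v := by rw [hm]; rfl
    simp only [add_apply, smul_apply, smul_eq_mul, Matrix.cons_val_zero, Matrix.cons_val_one,
      Matrix.cons_val, hX, hmv]
    field_simp
    ring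
  · rw [← LinearMap.ker_smul _ m hm0]
    congr 1
    refine LinearMap.ext fun v => ?_
    simp only [LinearMap.smul_apply, ContinuousLinearMap.coe_coe, veroneseCurve_coe_apply,
      add_apply, smul_apply, smul_eq_mul, Matrix.cons_val_zero, Matrix.cons_val_one,
      Matrix.cons_val, hX]
    field_simp
    ring

end LinearAlgebra

/-- By dimension the three functionals span the dual of ℝ³, so the coordinates of `w` vanish too. -/
theorem eq_zero_of_linearIndependent_dual {ξ : Fin 3 → R3 →L[ℝ] ℝ} (hξ : LinearIndependent ℝ ξ)
    {w : R3} (hw : ∀ i, ξ i w = 0) : w = 0 := by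
  have hspan : Submodule.span ℝ (Set.range ξ) = ⊤ := by
    refine hξ.span_eq_top_of_card_eq_finrank ?_
    rw [Fintype.card_fin]
    have e : (R3 →L[ℝ] ℝ) ≃ₗ[ℝ] (R3 →ₗ[ℝ] ℝ) := LinearMap.toContinuousLinearMap.symm
    rw [e.finrank_eq, Module.finrank_linearMap]
    simp
  have hall : ∀ a : R3 →L[ℝ] ℝ, a w = 0 := by
    intro a
    have ha : a ∈ Submodule.span ℝ (Set.range ξ) := by rw [hspan]; trivial
    induction ha using Submodule.span_induction with
    | mem a h => obtain ⟨i, rfl⟩ := h; exact hw i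
    | zero => rfl
    | add a b _ _ ha hb => rw [add_apply, ha, hb, add_zero]
    | smul c a _ ha => rw [smul_apply, ha, smul_zero]
  ext i
  exact hall (dcoord i)

/-! ### First integrals and charts on manifolds -/

section Manifold

variable {M : Type*} [TopologicalSpace M] [ChartedSpace R3 M]

theorem IsFirstIntegralOn.mono {D : TangentField M} {g : M → ℝ} {V V' : Set M}
    (h : IsFirstIntegralOn D g V) (hV : V' ⊆ V) : IsFirstIntegralOn D g V' :=
  ⟨h.1.mono hV, fun x hx => h.2 x (hV hx)⟩

theorem IsFirstIntegralOn.congr {D : TangentField M} {g g' : M → ℝ} {V : Set M}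
    (h : IsFirstIntegralOn D g V) (hV : IsOpen V) (hg : Set.EqOn g' g V) :
    IsFirstIntegralOn D g' V := by
  refine ⟨h.1.congr hg, fun x hx => ?_⟩
  have h1 : mfderiv (𝓡 3) 𝓘(ℝ, ℝ) g' x = mfderiv (𝓡 3) 𝓘(ℝ, ℝ) g x :=
    (hg.eventuallyEq_of_mem (hV.mem_nhds hx)).mfderiv_eq
  rw [h1]
  exact h.2 x hx

theorem IsFirstIntegralOn.mdifferentiableAt {D : TangentField M} {g : M → ℝ} {V : Set M}
    (h : IsFirstIntegralOn D g V) (hV : IsOpen V) {x : M} (hx : x ∈ V) :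
    MDifferentiableAt (𝓡 3) 𝓘(ℝ, ℝ) g x :=
  (h.1.contMDiffAt (hV.mem_nhds hx)).mdifferentiableAt (by simp)

theorem isLocalDiffeomorphAt_of_mem_maximalAtlas {x : OpenPartialHomeomorph M R3}
    (hx : x ∈ IsManifold.maximalAtlas (𝓡 3) ∞ M) {q : M} (hq : q ∈ x.source) :
    IsLocalDiffeomorphAt (𝓡 3) (𝓡 3) ∞ x q :=
  ⟨{ toPartialEquiv := x.toPartialEquiv
     open_source := x.open_source
     open_target := x.open_target
     contMDiffOn_toFun := contMDiffOn_of_mem_maximalAtlas hx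
     contMDiffOn_invFun := contMDiffOn_symm_of_mem_maximalAtlas hx }, hq, Set.eqOn_refl _ _⟩

theorem mfderiv_coord_chart {N : Type*} [TopologicalSpace N] [ChartedSpace R3 N]
    {Φ : N → R3} {q : N} (hΦ : MDifferentiableAt (𝓡 3) (𝓡 3) Φ q) (i : Fin 3) :
    mfderiv (𝓡 3) 𝓘(ℝ, ℝ) (fun q => Φ q i) q =
      (dcoord i).comp (mfderiv (𝓡 3) (𝓡 3) Φ q) := by
  have h1 : MDifferentiableAt (𝓡 3) 𝓘(ℝ, ℝ) (dcoord i) (Φ q) :=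
    (dcoord i).differentiableAt.mdifferentiableAt
  have := mfderiv_comp q h1 hΦ
  rw [mfderiv_eq_fderiv, (dcoord i).fderiv] at this
  exact this

theorem contDiffOn_comp_chart_symm {x : OpenPartialHomeomorph M R3}
    (hx : x ∈ IsManifold.maximalAtlas (𝓡 3) ∞ M) {V : Set M} (hVx : V ⊆ x.source) {f : M → ℝ}
    (hf : ContMDiffOn (𝓡 3) 𝓘(ℝ, ℝ) ∞ f V) : ContDiffOn ℝ ∞ (f ∘ x.symm) (x '' V) := by
  rw [← contMDiffOn_iff_contDiffOn]
  have hsub : x '' V ⊆ x.target := by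
    rintro _ ⟨q, hq, rfl⟩
    exact x.map_source (hVx hq)
  refine hf.comp ((contMDiffOn_symm_of_mem_maximalAtlas hx).mono hsub) ?_
  rintro _ ⟨q, hq, rfl⟩
  rwa [Set.mem_preimage, x.left_inv (hVx hq)]

theorem mfderiv_eq_fderiv_comp_chart_symm {x : OpenPartialHomeomorph M R3}
    (hx : x ∈ IsManifold.maximalAtlas (𝓡 3) ∞ M) {V : Set M} (hV : IsOpen V) (hVx : V ⊆ x.source)
    {f : M → ℝ} (hf : ContMDiffOn (𝓡 3) 𝓘(ℝ, ℝ) ∞ f V) {q : M} (hq : q ∈ V) :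
    mfderiv (𝓡 3) 𝓘(ℝ, ℝ) f q =
      (fderiv ℝ (f ∘ x.symm) (x q)).comp (mfderiv (𝓡 3) (𝓡 3) x q) := by
  have h1 : MDifferentiableAt (𝓡 3) 𝓘(ℝ, ℝ) (f ∘ x.symm) (x q) :=
    (((contDiffOn_comp_chart_symm hx hVx hf).contDiffAt
      ((x.isOpen_image_of_subset_source hV hVx).mem_nhds ⟨q, hq, rfl⟩)).differentiableAt
        (by simp)).mdifferentiableAt
  have h2 : MDifferentiableAt (𝓡 3) (𝓡 3) x q :=
    (isLocalDiffeomorphAt_of_mem_maximalAtlas hx (hVx hq)).mdifferentiableAt (by simp)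
  have h3 : (f ∘ x.symm) ∘ x =ᶠ[𝓝 q] f := by
    filter_upwards [hV.mem_nhds hq] with q' hq'
    simp [x.left_inv (hVx hq')]
  rw [← h3.mfderiv_eq, mfderiv_comp q h1 h2, mfderiv_eq_fderiv]
  rfl

theorem bijective_mfderiv_of_isLocalDiffeomorphAt {N : Type*} [TopologicalSpace N] [ChartedSpace R3 N]
    {Φ : M → N} {q : M} (hΦ : IsLocalDiffeomorphAt (𝓡 3) (𝓡 3) ∞ Φ q) :
    Function.Bijective (mfderiv (𝓡 3) (𝓡 3) Φ q) := by
  have := (hΦ.mfderivToContinuousLinearEquiv (by simp)).bijective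
  exact this

/-- In coordinates which straighten the foliations `F_{λ i}`, the whole web is determined by a
first integral of `F_∞`. -/
theorem eq_comap_hirotaWeb {l : Fin 3 → ℝ} (hl : Function.Injective l)
    {D : OnePoint ℝ → TangentField M} {x : OpenPartialHomeomorph M R3}
    (hx : x ∈ IsManifold.maximalAtlas (𝓡 3) ∞ M) {V : Set M} (hV : IsOpen V) (hVx : V ⊆ x.source)
    (hcoord : HasCoordinateFoliationsOn l D x V) {f : M → ℝ}
    (hf : IsFirstIntegralOn (D OnePoint.infty) f V) {q : M} (hq : q ∈ V)
    {α : Fin 3 → TangentSpace (𝓡 3) q →L[ℝ] ℝ} (hα : LinearIndependent ℝ α)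
    (hD : ∀ s, D s q = LinearMap.ker (veroneseCurve α s).toLinearMap) :
    (∀ i, pd i (f ∘ x.symm) (x q) ≠ 0) ∧
      ∀ s : OnePoint ℝ, D s q = (hirotaWeb l (f ∘ x.symm) s (x q)).comap
        (mfderiv (𝓡 3) (𝓡 3) x q).toLinearMap := by
  have hxq := isLocalDiffeomorphAt_of_mem_maximalAtlas hx (hVx hq)
  set A := mfderiv (𝓡 3) (𝓡 3) x q with hA
  have hAs : Function.Surjective A := (bijective_mfderiv_of_isLocalDiffeomorphAt hxq).2
  have hξ : ∀ i, mfderiv (𝓡 3) 𝓘(ℝ, ℝ) (fun q => x q i) q = (dcoord i).comp A :=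
    fun i => mfderiv_coord_chart (hxq.mdifferentiableAt (by simp)) i
  have hη := mfderiv_eq_fderiv_comp_chart_symm hx hV hVx hf.1 hq
  obtain ⟨c, hc0, hcη, hct⟩ := exists_ker_veroneseCurve_eq hl hα
    (ξ := fun i => mfderiv (𝓡 3) 𝓘(ℝ, ℝ) (fun q => x q i) q)
    (η := mfderiv (𝓡 3) 𝓘(ℝ, ℝ) f q)
    (fun i => ((hcoord i).2 q hq).1)
    (fun i => by rw [← hD]; exact ((hcoord i).2 q hq).2)
    (by rw [← hD]; exact (hf.2 q hq).2)
  -- The interpolation weights are the components of `df` in the coframe `dxᵢ`, read off on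
  -- preimages of the basis vectors.
  have hpd : ∀ i, pd i (f ∘ x.symm) (x q) = c i := by
    intro i
    obtain ⟨v, hv⟩ := hAs (EuclideanSpace.single i (1 : ℝ))
    have h1 := DFunLike.congr_fun hcη v
    have h2 := h1.symm.trans (DFunLike.congr_fun hη v)
    change _ = fderiv ℝ (f ∘ x.symm) (x q) (A v) at h2
    rw [hv] at h2
    rw [pd, ← h2, hξ, hξ, hξ]
    change c 0 * dcoord 0 (A v) + c 1 * dcoord 1 (A v) + c 2 * dcoord 2 (A v) = c i
    rw [hv]
    fin_cases i <;> simp [dcoord_single]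
  refine ⟨fun i => by rw [hpd]; exact hc0 i, fun s => ?_⟩
  induction s using OnePoint.rec with
  | infty =>
    rw [(hf.2 q hq).2, hη, hirotaWeb, hirotaForm_infty]
    rfl
  | coe t =>
    rw [hD, hct, hirotaWeb, hirotaForm_coe, hpd, hpd, hpd, hξ, hξ, hξ]
    rfl

variable [IsManifold (𝓡 3) ∞ M]

/-- In coordinates which straighten the foliations `F_{λ i}` of a Veronese web, first integrals of
`F_∞` solve the Hirota equation. -/
theorem isHirotaSolutionOn_of_isVeroneseWebOn {l : Fin 3 → ℝ} (hl : Function.Injective l)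
    {D : OnePoint ℝ → TangentField M} {U : Set M} (hD : IsVeroneseWebOn D U)
    {x : OpenPartialHomeomorph M R3} (hx : x ∈ IsManifold.maximalAtlas (𝓡 3) ∞ M) {V : Set M}
    (hV : IsOpen V) (hVx : V ⊆ x.source) (hVU : V ⊆ U)
    (hcoord : HasCoordinateFoliationsOn l D x V) {f : M → ℝ}
    (hf : IsFirstIntegralOn (D OnePoint.infty) f V) :
    IsHirotaSolutionOn l (f ∘ x.symm) (x '' V) ∧
      ∀ q ∈ V, ∀ s : OnePoint ℝ, D s q = (hirotaWeb l (f ∘ x.symm) s (x q)).comap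
        (mfderiv (𝓡 3) (𝓡 3) x q).toLinearMap := by
  have hmain : ∀ q ∈ V, (∀ i, pd i (f ∘ x.symm) (x q) ≠ 0) ∧
      ∀ s : OnePoint ℝ, D s q = (hirotaWeb l (f ∘ x.symm) s (x q)).comap
        (mfderiv (𝓡 3) (𝓡 3) x q).toLinearMap := fun q hq => by
    obtain ⟨V', -, hqV', -, α, -, hα⟩ := hD.2 q (hVU hq)
    exact eq_comap_hirotaWeb hl hx hV hVx hcoord hf hq (hα q hqV').1 (hα q hqV').2
  have hfs := contDiffOn_comp_chart_symm hx hVx hf.1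
  refine ⟨⟨hfs, ?_, ?_⟩, fun q hq => (hmain q hq).2⟩
  · rintro _ ⟨q, hq, rfl⟩
    -- At a node the kernel is that of `dxᵢ`, which says nothing about `f`; any single other value
    -- of `t` gives the equation.
    obtain ⟨t, ht⟩ := (Set.finite_range l).infinite_compl.nonempty
    have ht' : ∀ i, l i ≠ t := fun i hi => ht ⟨i, hi⟩
    obtain ⟨V', hV', hqV', -, g, hg⟩ := hD.1 t q (hVU hq)
    have hVV : V ∩ V' ⊆ x.source := fun y hy => hVx hy.1
    have hVVo : IsOpen (V ∩ V') := hV.inter hV'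
    have hg' := hg.mono (Set.inter_subset_right : V ∩ V' ⊆ V')
    have key : ∀ y ∈ V ∩ V', fderiv ℝ (g ∘ x.symm) (x y) ≠ 0 ∧
        LinearMap.ker (hirotaForm l (f ∘ x.symm) (t : OnePoint ℝ) (x y)).toLinearMap =
          LinearMap.ker (fderiv ℝ (g ∘ x.symm) (x y)).toLinearMap := by
      intro y hy
      have hη := mfderiv_eq_fderiv_comp_chart_symm hx hVVo hVV hg'.1 hy
      obtain ⟨h0, h1⟩ := hg'.2 y hy
      refine ⟨fun h => h0 (by rw [hη, h]; rfl), ?_⟩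
      have hAs := (bijective_mfderiv_of_isLocalDiffeomorphAt
        (isLocalDiffeomorphAt_of_mem_maximalAtlas hx (hVV hy))).2
      refine Submodule.comap_injective_of_surjective
        (f := (mfderiv (𝓡 3) (𝓡 3) x y).toLinearMap) hAs ?_
      have h2 := (hmain y hy.1).2 t
      rw [h1, hη] at h2
      exact h2.symm
    refine hirota_equation_of_ker_eq (x.isOpen_image_of_subset_source hVVo hVV)
      (hfs.mono (Set.image_mono Set.inter_subset_left))
      (contDiffOn_comp_chart_symm hx hVV hg'.1) ht' ?_ ?_ ⟨q, ⟨hq, hqV'⟩, rfl⟩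
    · rintro _ ⟨y, hy, rfl⟩
      exact (key y hy).1
    · rintro _ ⟨y, hy, rfl⟩
      exact (key y hy).2
  · rintro _ ⟨q, hq, rfl⟩
    exact (hmain q hq).1

/-- Near every point of a Veronese web there are coordinates which straighten `F_{λ i}`. -/
theorem exists_chart_hasCoordinateFoliationsOn {l : Fin 3 → ℝ} (hl : Function.Injective l)
    {D : OnePoint ℝ → TangentField M} {U : Set M} (hD : IsVeroneseWebOn D U) {p : M} (hp : p ∈ U) :
    ∃ x ∈ IsManifold.maximalAtlas (𝓡 3) ∞ M, p ∈ x.source ∧ x.source ⊆ U ∧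
      HasCoordinateFoliationsOn l D x x.source := by
  choose V hV hpV hVU g hg using fun i : Fin 3 => hD.1 (l i) p hp
  obtain ⟨V', -, hpV', -, α, -, hα⟩ := hD.2 p hp
  set φ := chartAt R3 p with hφ
  have hφa : φ ∈ IsManifold.maximalAtlas (𝓡 3) ∞ M := IsManifold.chart_mem_maximalAtlas p
  have hpφ : p ∈ φ.source := mem_chart_source R3 p
  set W : Set M := φ.source ∩ ⋂ i, V i with hW
  have hWo : IsOpen W := φ.open_source.inter (isOpen_iInter_of_finite hV)
  have hpW : p ∈ W := ⟨hpφ, Set.mem_iInter.2 hpV⟩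
  have hWφ : W ⊆ φ.source := Set.inter_subset_left
  have hgW : ∀ i, IsFirstIntegralOn (D (l i)) (g i) W := fun i =>
    (hg i).mono fun y hy => Set.mem_iInter.1 hy.2 i
  -- The new coordinates are first integrals of the three foliations; independence of their
  -- differentials at `p` makes `F` a local diffeomorphism.
  let F : R3 → R3 := fun y => WithLp.toLp 2 fun i => g i (φ.symm y)
  have hFi : ∀ i, ContDiffOn ℝ ∞ (fun y => F y i) (φ '' W) := fun i =>
    contDiffOn_comp_chart_symm hφa hWφ (hgW i).1
  have hF : ContDiffOn ℝ ∞ F (φ '' W) := contDiffOn_euclidean.2 hFi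
  have hpW' : φ p ∈ φ '' W := ⟨p, hpW, rfl⟩
  have hφWo := φ.isOpen_image_of_subset_source hWo hWφ
  have hFd : HasFDerivAt F (fderiv ℝ F (φ p)) (φ p) :=
    ((hF.contDiffAt (hφWo.mem_nhds hpW')).differentiableAt (by simp)).hasFDerivAt
  have hinj : Function.Injective (fderiv ℝ F (φ p)) := by
    rw [injective_iff_map_eq_zero]
    intro v hv
    obtain ⟨w, rfl⟩ := (bijective_mfderiv_of_isLocalDiffeomorphAt
      (isLocalDiffeomorphAt_of_mem_maximalAtlas hφa hpφ)).2 v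
    have hli := linearIndependent_of_ker_veroneseCurve hl (hα p hpV').1
      (ξ := fun i => mfderiv (𝓡 3) 𝓘(ℝ, ℝ) (g i) p)
      (fun i => by rw [← (hα p hpV').2]; exact ((hgW i).2 p hpW).2)
    have hw : w = 0 := eq_zero_of_linearIndependent_dual hli fun i => by
      have h1 := mfderiv_eq_fderiv_comp_chart_symm hφa hWo hWφ (hgW i).1 hpW
      have h2 : fderiv ℝ (g i ∘ φ.symm) (φ p) = (dcoord i).comp (fderiv ℝ F (φ p)) :=
        ((dcoord i).hasFDerivAt.comp (φ p) hFd).fderiv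
      rw [h1, h2]
      exact (congrArg (dcoord i) hv).trans (map_zero _)
    rw [hw]
    exact map_zero _
  let F' : R3 ≃L[ℝ] R3 :=
    (LinearEquiv.ofInjectiveEndo (fderiv ℝ F (φ p)).toLinearMap hinj).toContinuousLinearEquiv
  obtain ⟨e, hpe, heW, hee, hes⟩ := exists_openPartialHomeomorph_of_fderiv_equiv hφWo hF hpW' F'
    (by ext v; rfl)
  set x := φ.trans e with hx
  have hxsource : x.source ⊆ W := by
    intro y hy
    rw [hx, OpenPartialHomeomorph.trans_source] at hy
    obtain ⟨z, hz, hzy⟩ := heW hy.2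
    rwa [← φ.injOn (hWφ hz) hy.1 hzy]
  have hxg : ∀ i, Set.EqOn (fun q => x q i) (g i) x.source := by
    intro i y hy
    have h1 : x y = F (φ y) := by rw [← hee]; rfl
    simp only [h1]
    change g i (φ.symm (φ y)) = _
    rw [φ.left_inv (hWφ (hxsource hy))]
  refine ⟨x, ?_, ?_, fun y hy => hVU 0 (Set.mem_iInter.1 (hxsource hy).2 0), fun i => ?_⟩
  · refine x.mem_maximalAtlas_of_contMDiffOn ?_ ?_
    · have h1 : ContMDiffOn (𝓡 3) (𝓡 3) ∞ e e.source := by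
        rw [hee]; exact (hF.mono heW).contMDiffOn
      exact h1.comp ((contMDiffOn_of_mem_maximalAtlas hφa).mono fun y hy => hy.1)
        fun y hy => hy.2
    · exact (contMDiffOn_symm_of_mem_maximalAtlas hφa).comp
        (hes.contMDiffOn.mono fun y hy => hy.1) fun y hy => hy.2
  · rw [hx, OpenPartialHomeomorph.trans_source]
    exact ⟨hpφ, hpe⟩
  · exact ((hgW i).mono hxsource).congr x.open_source (hxg i)

end Manifold

/-! ### Local diffeomorphisms of vector spaces -/

section LocalDiffeomorph

variable {E : Type*} [NormedAddCommGroup E] [NormedSpace ℝ E]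

theorem exists_openPartialHomeomorph_of_injective_fderiv [FiniteDimensional ℝ E] {f : E → E}
    {U : Set E} (hU : IsOpen U) (hf : ContDiffOn ℝ ∞ f U) {a : E} (ha : a ∈ U)
    (hinj : Function.Injective (fderiv ℝ f a)) :
    ∃ e : OpenPartialHomeomorph E E, a ∈ e.source ∧ e.source ⊆ U ∧ (e : E → E) = f ∧
      ContDiffOn ℝ ∞ e.symm e.target := by
  have : CompleteSpace E := FiniteDimensional.complete ℝ E
  exact exists_openPartialHomeomorph_of_fderiv_equiv hU hf ha
    (LinearEquiv.ofInjectiveEndo (fderiv ℝ f a).toLinearMap hinj).toContinuousLinearEquiv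
    (by ext v; rfl)

theorem isLocalDiffeomorphAt_of_injective_fderiv [FiniteDimensional ℝ E] {f : E → E}
    {U : Set E} (hU : IsOpen U) (hf : ContDiffOn ℝ ∞ f U) {a : E} (ha : a ∈ U)
    (hinj : Function.Injective (fderiv ℝ f a)) :
    IsLocalDiffeomorphAt 𝓘(ℝ, E) 𝓘(ℝ, E) ∞ f a := by
  obtain ⟨e, hae, heU, hef, hes⟩ := exists_openPartialHomeomorph_of_injective_fderiv hU hf ha hinj
  exact ⟨{ toPartialEquiv := e.toPartialEquiv
           open_source := e.open_source
           open_target := e.open_target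
           contMDiffOn_toFun := by
            change ContMDiffOn _ _ _ e _
            rw [hef]; exact (hf.mono heU).contMDiffOn
           contMDiffOn_invFun := hes.contMDiffOn }, hae, fun y _ => (congrFun hef y).symm⟩

theorem IsLocalDiffeomorphAt.eventually {M N : Type*} [TopologicalSpace M] [TopologicalSpace N]
    {F : Type*} [NormedAddCommGroup F] [NormedSpace ℝ F] [ChartedSpace E M] [ChartedSpace F N]
    {f : M → N} {a : M} (h : IsLocalDiffeomorphAt 𝓘(ℝ, E) 𝓘(ℝ, F) ∞ f a) :
    ∀ᶠ x in 𝓝 a, IsLocalDiffeomorphAt 𝓘(ℝ, E) 𝓘(ℝ, F) ∞ f x := by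
  obtain ⟨Φ, ha, hf⟩ := h
  filter_upwards [Φ.open_source.mem_nhds ha] with x hx
  exact ⟨Φ, hx, hf⟩

theorem IsLocalDiffeomorphAt.deriv_ne_zero {φ : ℝ → ℝ} {a : ℝ}
    (h : IsLocalDiffeomorphAt 𝓘(ℝ, ℝ) 𝓘(ℝ, ℝ) ∞ φ a) : deriv φ a ≠ 0 := by
  have h1 : Function.Injective (mfderiv 𝓘(ℝ, ℝ) 𝓘(ℝ, ℝ) φ a) :=
    (h.mfderivToContinuousLinearEquiv (by simp)).injective
  rw [mfderiv_eq_fderiv] at h1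
  intro h0
  have h2 : fderiv ℝ φ a (1 : ℝ) = fderiv ℝ φ a (0 : ℝ) := by
    rw [fderiv_apply_one_eq_deriv, h0]; exact (map_zero _).symm
  exact (one_ne_zero : (1 : ℝ) ≠ 0) (h1 h2)

theorem IsLocalDiffeomorphAt.contDiffAt' {φ : ℝ → ℝ} {a : ℝ}
    (h : IsLocalDiffeomorphAt 𝓘(ℝ, ℝ) 𝓘(ℝ, ℝ) ∞ φ a) : ContDiffAt ℝ ∞ φ a :=
  contMDiffAt_iff_contDiffAt.1 h.contMDiffAt

theorem fderiv_comp_of_isLocalDiffeomorphAt {φ : ℝ → ℝ} {g : E → ℝ} {x : E}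
    (h : IsLocalDiffeomorphAt 𝓘(ℝ, ℝ) 𝓘(ℝ, ℝ) ∞ φ (g x)) (hg : DifferentiableAt ℝ g x) :
    fderiv ℝ (fun y => φ (g y)) x = deriv φ (g x) • fderiv ℝ g x :=
  ((h.contDiffAt'.differentiableAt (by simp)).hasDerivAt.comp_hasFDerivAt x hg.hasFDerivAt).fderiv

/-- A product of local diffeomorphisms of the line. -/
theorem isLocalDiffeomorphAt_prod {φ : Fin 3 → ℝ → ℝ} {p : R3}
    (h : ∀ i, IsLocalDiffeomorphAt 𝓘(ℝ, ℝ) 𝓘(ℝ, ℝ) ∞ (φ i) (p i)) :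
    IsLocalDiffeomorphAt (𝓡 3) (𝓡 3) ∞ (fun x : R3 => (WithLp.toLp 2 fun i => φ i (x i) : R3)) p := by
  have hev : ∀ᶠ x in 𝓝 p, ∀ i, IsLocalDiffeomorphAt 𝓘(ℝ, ℝ) 𝓘(ℝ, ℝ) ∞ (φ i) (x i) := by
    rw [Filter.eventually_all]
    intro i
    exact (dcoord i).continuous.continuousAt.eventually (h i).eventually
  obtain ⟨U, hUφ, hU, hpU⟩ := eventually_nhds_iff.1 hev
  have hsm : ContDiffOn ℝ ∞ (fun x : R3 => (WithLp.toLp 2 fun i => φ i (x i) : R3)) U := by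
    refine contDiffOn_euclidean.2 fun i x hx => ContDiffAt.contDiffWithinAt ?_
    exact (hUφ x hx i).contDiffAt'.comp x (dcoord i).contDiff.contDiffAt
  refine isLocalDiffeomorphAt_of_injective_fderiv hU hsm hpU ?_
  rw [injective_iff_map_eq_zero]
  intro v hv
  have hd := ((hsm.contDiffAt (hU.mem_nhds hpU)).differentiableAt (by simp)).hasFDerivAt
  ext i
  have h1 := (dcoord i).hasFDerivAt.comp p hd
  have h2 : fderiv ℝ (fun x : R3 => φ i (dcoord i x)) p = _ :=
    fderiv_comp_of_isLocalDiffeomorphAt (h i) (dcoord i).differentiableAt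
  have h3 := DFunLike.congr_fun (h1.fderiv.symm.trans h2) v
  rw [(dcoord i).fderiv, ContinuousLinearMap.comp_apply, hv, map_zero, smul_apply, smul_eq_mul] at h3
  exact (mul_eq_zero.1 h3.symm).resolve_left (h i).deriv_ne_zero

end LocalDiffeomorph

/-! ### First integrals of the same foliation -/

/-- Two first integrals of the same foliation are locally functions of each other. -/
theorem exists_eq_comp_of_isFirstIntegralOn {D : TangentField R3} {u v : R3 → ℝ} {U : Set R3}
    (hU : IsOpen U) (hu : IsFirstIntegralOn D u U) (hv : IsFirstIntegralOn D v U) {p : R3}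
    (hp : p ∈ U) :
    ∃ ψ : ℝ → ℝ, IsLocalDiffeomorphAt 𝓘(ℝ, ℝ) 𝓘(ℝ, ℝ) ∞ ψ (v p) ∧
      ∀ᶠ y in 𝓝 p, u y = ψ (v y) := by
  rw [isFirstIntegralOn_iff_fderiv] at hu hv
  obtain ⟨hus, hud⟩ := hu
  obtain ⟨hvs, hvd⟩ := hv
  have hudiff : ∀ y ∈ U, HasFDerivAt u (fderiv ℝ u y) y := fun y hy =>
    ((hus.contDiffAt (hU.mem_nhds hy)).differentiableAt (by simp)).hasFDerivAt
  have hvdiff : ∀ y ∈ U, HasFDerivAt v (fderiv ℝ v y) y := fun y hy =>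
    ((hvs.contDiffAt (hU.mem_nhds hy)).differentiableAt (by simp)).hasFDerivAt
  have hker : ∀ y ∈ U, ∀ w, fderiv ℝ u y w = 0 ↔ fderiv ℝ v y w = 0 := fun y hy w => by
    have h1 : w ∈ LinearMap.ker (fderiv ℝ u y).toLinearMap ↔
        w ∈ LinearMap.ker (fderiv ℝ v y).toLinearMap := by
      rw [← (hvd y hy).2, ← (hud y hy).2]
    exact h1
  obtain ⟨i, hi⟩ : ∃ i, fderiv ℝ v p (EuclideanSpace.single i 1) ≠ 0 := by
    by_contra! hcon
    refine (hvd p hp).1 ?_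
    rw [clm_eq_sum_dcoord (fderiv ℝ v p), hcon, hcon, hcon]
    simp
  -- coordinates in which `v` is linear
  let b : R3 := EuclideanSpace.single i 1
  have hb1 : dcoord i b = 1 := by simp [b, dcoord_single]
  have hbn : ‖b‖ = 1 := by simp [b]
  let Θ : R3 → R3 := fun y => y + (v y - dcoord i y) • b
  have hΘ : ContDiffOn ℝ ∞ Θ U :=
    contDiffOn_id.add ((hvs.sub (dcoord i).contDiff.contDiffOn).smul contDiffOn_const)
  have hΘi : ∀ y, dcoord i (Θ y) = v y := fun y => by
    simp only [Θ, map_add, map_smul, hb1, smul_eq_mul, mul_one]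
    ring
  have hinj : Function.Injective (fderiv ℝ Θ p) := by
    have hd : HasFDerivAt Θ (ContinuousLinearMap.id ℝ R3 +
        (fderiv ℝ v p - dcoord i).smulRight b) p :=
      (hasFDerivAt_id p).add (((hvdiff p hp).sub (dcoord i).hasFDerivAt).smul_const b)
    rw [hd.fderiv, injective_iff_map_eq_zero]
    intro w hw
    simp only [add_apply, ContinuousLinearMap.id_apply, ContinuousLinearMap.smulRight_apply,
      sub_apply] at hw
    have h1 : fderiv ℝ v p w = 0 := by
      have := congrArg (dcoord i) hw
      simp only [map_add, map_smul, hb1, smul_eq_mul, mul_one, map_zero] at this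
      linarith
    have h2 : w = dcoord i w • b := by
      rw [h1, zero_sub, neg_smul, ← sub_eq_add_neg, sub_eq_zero] at hw
      exact hw
    rw [h2, map_smul, smul_eq_mul] at h1
    rw [h2, (mul_eq_zero.1 h1).resolve_right hi, zero_smul]
  obtain ⟨e, hpe, heU, heΘ, hes⟩ :=
    exists_openPartialHomeomorph_of_injective_fderiv hU hΘ hp hinj
  have het : Θ p ∈ e.target := by rw [← heΘ]; exact e.map_source hpe
  have hep : e.symm (Θ p) = p := by rw [← heΘ]; exact e.left_inv hpe
  obtain ⟨r, hr, hball⟩ := Metric.isOpen_iff.1 e.open_target _ het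
  have hsymm : ∀ z ∈ e.target, HasFDerivAt e.symm (fderiv ℝ e.symm z) z := fun z hz =>
    ((hes.contDiffAt (e.open_target.mem_nhds hz)).differentiableAt (by simp)).hasFDerivAt
  have hU' : ∀ z ∈ e.target, e.symm z ∈ U := fun z hz => heU (e.map_target hz)
  have hvz : ∀ z ∈ e.target, ∀ w, fderiv ℝ v (e.symm z) (fderiv ℝ e.symm z w) = dcoord i w := by
    intro z hz w
    have h1 := (hvdiff _ (hU' z hz)).comp z (hsymm z hz)
    have h2 : v ∘ e.symm =ᶠ[𝓝 z] dcoord i := by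
      filter_upwards [e.open_target.mem_nhds hz] with z' hz'
      have := e.right_inv hz'
      rw [heΘ] at this
      rw [Function.comp_apply, ← hΘi, this]
    exact DFunLike.congr_fun (h1.unique ((dcoord i).hasFDerivAt.congr_of_eventuallyEq h2)) w
  let ut : R3 → ℝ := fun z => u (e.symm z)
  have hut : ∀ z ∈ e.target, HasFDerivAt ut ((fderiv ℝ u (e.symm z)).comp (fderiv ℝ e.symm z)) z :=
    fun z hz => (hudiff _ (hU' z hz)).comp z (hsymm z hz)
  have hutk : ∀ z ∈ e.target, ∀ w, fderiv ℝ u (e.symm z) (fderiv ℝ e.symm z w) = 0 ↔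
      dcoord i w = 0 := fun z hz w => by rw [hker _ (hU' z hz), hvz z hz]
  -- `Θ` replaces the coordinate `i` by `v`, and `γ τ` is the point with coordinate `i` equal to `τ`
  -- on the line through `Θ p` in direction `b`. Restricting `u` to this line, in the new
  -- coordinates, defines `ψ`.
  let γ : ℝ → R3 := fun τ => Θ p + (τ - v p) • b
  have hγ : ContDiff ℝ ∞ γ :=
    contDiff_const.add ((contDiff_id.sub contDiff_const).smul contDiff_const)
  have hγp : γ (v p) = Θ p := by simp [γ]
  have hγd : HasDerivAt γ b (v p) := by
    exact ((((hasDerivAt_id (v p)).sub_const (v p)).smul_const b).const_add (Θ p)).congr_deriv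
      (one_smul ℝ b)
  refine ⟨fun τ => ut (γ τ), ?_, ?_⟩
  · have huts : ContDiffOn ℝ ∞ ut e.target := hus.comp hes hU'
    have hmem : v p ∈ γ ⁻¹' e.target := by rw [Set.mem_preimage, hγp]; exact het
    refine isLocalDiffeomorphAt_of_injective_fderiv (e.open_target.preimage hγ.continuous)
      (huts.comp hγ.contDiffOn fun τ hτ => hτ) hmem ?_
    have h1 : HasDerivAt (ut ∘ γ) _ (v p) :=
      HasFDerivAt.comp_hasDerivAt (l := ut) (f := γ) (v p) (hut _ hmem) hγd
    rw [h1.hasFDerivAt.fderiv, injective_iff_map_eq_zero]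
    intro c hc
    simp only [ContinuousLinearMap.toSpanSingleton_apply, smul_eq_mul] at hc
    refine (mul_eq_zero.1 hc).resolve_right fun h0 => ?_
    have := (hutk _ hmem b).1 h0
    rw [hb1] at this
    exact one_ne_zero this
  · have hΘc : ContinuousAt Θ p := (hΘ.contDiffAt (hU.mem_nhds hp)).continuousAt
    filter_upwards [hΘc.eventually (Metric.ball_mem_nhds _ hr), e.open_source.mem_nhds hpe]
      with y hy hye
    have hz0 : γ (v y) ∈ Metric.ball (Θ p) r := by
      rw [dist_eq_norm] at hy
      rw [mem_ball_iff_norm]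
      simp only [γ, add_sub_cancel_left, norm_smul, hbn, mul_one, ← hΘi, ← map_sub]
      exact (PiLp.norm_apply_le (Θ y - Θ p) i).trans_lt hy
    have huy : u y = ut (Θ y) := by
      have : e.symm (Θ y) = y := by rw [← heΘ]; exact e.left_inv hye
      simp only [ut, this]
    rw [huy]
    -- Both ends have coordinate `i` equal to `v y`, and `ut` has zero derivative in directions
    -- without that coordinate. The convex ball keeps the segment in the domain, so `ut` agrees at
    -- its ends.
    have hlin : ∀ s ∈ Set.Icc (0 : ℝ) 1, γ (v y) + s • (Θ y - γ (v y)) ∈ e.target := fun s hs =>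
      hball ((convex_ball _ _).add_smul_sub_mem hz0 (Metric.mem_ball.2 hy) hs)
    have h0 : dcoord i (Θ y - γ (v y)) = 0 := by
      simp [γ, hΘi, hb1]
    have hderiv : ∀ s ∈ Set.Icc (0 : ℝ) 1,
        HasDerivAt (fun s : ℝ => ut (γ (v y) + s • (Θ y - γ (v y)))) 0 s := by
      intro s hs
      have h1 : HasDerivAt (fun s : ℝ => γ (v y) + s • (Θ y - γ (v y))) (Θ y - γ (v y)) s := by
        simpa using ((hasDerivAt_id s).smul_const (Θ y - γ (v y))).const_add (γ (v y))
      have h2 : HasDerivAt (fun s : ℝ => ut (γ (v y) + s • (Θ y - γ (v y)))) _ s :=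
        HasFDerivAt.comp_hasDerivAt (l := ut)
          (f := fun s : ℝ => γ (v y) + s • (Θ y - γ (v y))) s (hut _ (hlin s hs)) h1
      exact h2.congr_deriv ((hutk _ (hlin s hs) _).2 h0)
    have := constant_of_has_deriv_right_zero
      (fun s hs => (hderiv s hs).continuousAt.continuousWithinAt)
      (fun s hs => (hderiv s (Set.Ico_subset_Icc_self hs)).hasDerivWithinAt) 1
      (Set.right_mem_Icc.2 zero_le_one)
    simpa using this

/-! ### Pulling back webs by local diffeomorphisms -/

section Pullback

variable {M : Type*} [TopologicalSpace M] [ChartedSpace R3 M]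

theorem IsFirstIntegralOn.comp_isLocalDiffeomorphAt {D : TangentField M} {D' : TangentField R3}
    {g : R3 → ℝ} {V : Set M} {V' : Set R3} {Φ : M → R3} (hV' : IsOpen V')
    (hg : IsFirstIntegralOn D' g V')
    (hΦ : ∀ q ∈ V, IsLocalDiffeomorphAt (𝓡 3) (𝓡 3) ∞ Φ q ∧ Φ q ∈ V' ∧
      D q = (D' (Φ q)).comap (mfderiv (𝓡 3) (𝓡 3) Φ q).toLinearMap) :
    IsFirstIntegralOn D (fun q => g (Φ q)) V := by
  refine ⟨fun q hq => ?_, fun q hq => ?_⟩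
  · obtain ⟨h1, h2, -⟩ := hΦ q hq
    exact ((hg.1.contMDiffAt (hV'.mem_nhds h2)).comp q h1.contMDiffAt).contMDiffWithinAt
  · obtain ⟨h1, h2, h3⟩ := hΦ q hq
    have hd : mfderiv (𝓡 3) 𝓘(ℝ, ℝ) (fun q => g (Φ q)) q =
        (mfderiv (𝓡 3) 𝓘(ℝ, ℝ) g (Φ q)).comp (mfderiv (𝓡 3) (𝓡 3) Φ q) :=
      mfderiv_comp q (hg.mdifferentiableAt hV' h2) (h1.mdifferentiableAt (by simp))
    have hs := (bijective_mfderiv_of_isLocalDiffeomorphAt h1).2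
    obtain ⟨h4, h5⟩ := hg.2 _ h2
    refine ⟨fun h0 => h4 (ContinuousLinearMap.ext fun v => ?_), ?_⟩
    · obtain ⟨w, rfl⟩ := hs v
      rw [hd] at h0
      exact DFunLike.congr_fun h0 w
    · rw [h3, h5, hd]
      rfl

theorem exists_chart_of_isLocalDiffeomorphAt [IsManifold (𝓡 3) ∞ M] {Φ : M → R3} {p : M}
    (hΦ : IsLocalDiffeomorphAt (𝓡 3) (𝓡 3) ∞ Φ p) :
    ∃ x ∈ IsManifold.maximalAtlas (𝓡 3) ∞ M, p ∈ x.source ∧ Set.EqOn Φ x x.source := by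
  obtain ⟨P, hp, hP⟩ := hΦ
  exact ⟨P.toOpenPartialHomeomorph, OpenPartialHomeomorph.mem_maximalAtlas_of_contMDiffOn _
    P.contMDiffOn_toFun P.contMDiffOn_invFun, hp, hP⟩

/-- All tangent spaces are definitionally ℝ³, which lets a vector be moved between fibres over equal
but not syntactically identical points such as `Φ (Ψ y)` and `y`. -/
theorem mem_tangentField_congr (D : TangentField M) {z z' : M} (h : z = z') (v : R3) :
    (show TangentSpace (𝓡 3) z from v) ∈ D z ↔ (show TangentSpace (𝓡 3) z' from v) ∈ D z' := by
  subst h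
  rfl

end Pullback

/-! ### Invariance of the Hirota equation under the relation ∼ -/

section Hirota

variable {l : Fin 3 → ℝ} {f f' : R3 → ℝ} {U : Set R3}

theorem pd_congr {x : R3} (h : f' =ᶠ[𝓝 x] f) (i : Fin 3) : pd i f' x = pd i f x := by
  rw [pd, pd, h.fderiv_eq]

theorem pd_eventuallyEq {x : R3} (h : f' =ᶠ[𝓝 x] f) (i : Fin 3) : pd i f' =ᶠ[𝓝 x] pd i f := by
  filter_upwards [h.eventuallyEq_nhds] with y hy
  exact pd_congr hy i

theorem IsHirotaSolutionOn.congr (h : IsHirotaSolutionOn l f U) (hU : IsOpen U)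
    (hf : Set.EqOn f' f U) : IsHirotaSolutionOn l f' U := by
  have hev : ∀ x ∈ U, f' =ᶠ[𝓝 x] f := fun x hx => hf.eventuallyEq_of_mem (hU.mem_nhds hx)
  refine ⟨h.smooth.congr hf, fun x hx => ?_, fun x hx i => ?_⟩
  · rw [pd_congr (hev x hx), pd_congr (hev x hx), pd_congr (hev x hx),
      pd_congr (pd_eventuallyEq (hev x hx) 2), pd_congr (pd_eventuallyEq (hev x hx) 0),
      pd_congr (pd_eventuallyEq (hev x hx) 1)]
    exact h.equation x hx
  · rw [pd_congr (hev x hx)]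
    exact h.pd_ne_zero x hx i

theorem hirotaWeb_congr {x : R3} (h : f' =ᶠ[𝓝 x] f) (s : OnePoint ℝ) :
    hirotaWeb l f' s x = hirotaWeb l f s x := by
  have h' : hirotaForm l f' s x = hirotaForm l f s x := by
    induction s using OnePoint.rec with
    | infty => rw [hirotaForm_infty, hirotaForm_infty, h.fderiv_eq]
    | coe t => rw [hirotaForm_coe, hirotaForm_coe, pd_congr h, pd_congr h, pd_congr h]
  rw [hirotaWeb, hirotaWeb, h']

/-- The relation `∼` preserves solutions, and identifies their Veronese webs. -/
theorem FunEquivAt.exists_chart (hl : Function.Injective l) {g : R3 → ℝ} {p q : R3}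
    (h : FunEquivAt f p g q) (hU : IsOpen U) (hp : p ∈ U) (hf : IsHirotaSolutionOn l f U)
    {V₀ : Set R3} (hV₀ : IsOpen V₀) (hq : q ∈ V₀) (hg : ContDiffOn ℝ ∞ g V₀) :
    ∃ x ∈ IsManifold.maximalAtlas (𝓡 3) ∞ R3, p ∈ x.source ∧ x p = q ∧ ∃ V : Set R3, IsOpen V ∧
      p ∈ V ∧ V ⊆ x.source ∧ IsHirotaSolutionOn l g (x '' V) ∧ ∀ y ∈ V, ∀ s : OnePoint ℝ,
        hirotaWeb l f s y = (hirotaWeb l g s (x y)).comap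
          (mfderiv (𝓡 3) (𝓡 3) x y).toLinearMap := by
  obtain ⟨ψ, φ, hψ, hφ, hfg⟩ := h
  set Φ : R3 → R3 := fun x => WithLp.toLp 2 fun i => φ i (x i) with hΦ
  have hΦd : IsLocalDiffeomorphAt (𝓡 3) (𝓡 3) ∞ Φ p := isLocalDiffeomorphAt_prod fun i => (hφ i).1
  have hΦp : Φ p = q := by
    ext i
    exact (hφ i).2
  obtain ⟨x, hx, hpx, hxΦ⟩ := exists_chart_of_isLocalDiffeomorphAt hΦd
  have hΦc : ContinuousAt Φ p := hΦd.contMDiffAt.continuousAt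
  have hgc : ContinuousAt (fun y => g (Φ y)) p := by
    refine ContinuousAt.comp ?_ hΦc
    rw [hΦp]
    exact (hg.contDiffAt (hV₀.mem_nhds hq)).continuousAt
  have e1 : ∀ᶠ y in 𝓝 p, y ∈ U := hU.mem_nhds hp
  have e2 : ∀ᶠ y in 𝓝 p, y ∈ x.source := x.open_source.mem_nhds hpx
  have e3 : ∀ᶠ y in 𝓝 p, Φ y ∈ V₀ := hΦc.eventually_mem (hV₀.mem_nhds (by rwa [hΦp]))
  have e4 : ∀ᶠ y in 𝓝 p, IsLocalDiffeomorphAt 𝓘(ℝ, ℝ) 𝓘(ℝ, ℝ) ∞ ψ (g (Φ y)) :=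
    hgc.eventually (by simp only [hΦp]; exact hψ.eventually)
  have e5 : ∀ᶠ y in 𝓝 p, ∀ i, IsLocalDiffeomorphAt 𝓘(ℝ, ℝ) 𝓘(ℝ, ℝ) ∞ (φ i) (y i) := by
    rw [Filter.eventually_all]
    intro i
    exact (dcoord i).continuous.continuousAt.eventually (hφ i).1.eventually
  obtain ⟨V, hVall, hV, hpV⟩ := eventually_nhds_iff.1
    (e1.and (e2.and (e3.and (e4.and (e5.and (hfg.eventually_nhds))))))
  have hVx : V ⊆ x.source := fun y hy => (hVall y hy).2.1
  have hVU : V ⊆ U := fun y hy => (hVall y hy).1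
  have hxV : Set.EqOn x Φ V := fun y hy => (hxΦ (hVx hy)).symm
  -- No chain rule for second derivatives is needed. The product map is a chart straightening the
  -- same three foliations of the web of `f`, and in it `g` represents a first integral of `F_∞`
  -- because `f = ψ (g ∘ Φ)`; so `g` is a solution.
  have hcoord : HasCoordinateFoliationsOn l (hirotaWeb l f) x V := by
    intro i
    have h0 := isFirstIntegralOn_iff_fderiv.1
      ((isFirstIntegralOn_coord_hirotaWeb hl hf.pd_ne_zero i).mono hVU)
    refine (isFirstIntegralOn_iff_fderiv.2 ⟨fun y hy => ?_, fun y hy => ?_⟩ :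
      IsFirstIntegralOn _ (fun y => φ i (y i)) V).congr hV fun y hy => ?_
    · exact (((hVall y hy).2.2.2.2.1 i).contDiffAt'.comp y
        (dcoord i).contDiff.contDiffAt).contDiffWithinAt
    · obtain ⟨h1, h2⟩ := h0.2 y hy
      have h3 : fderiv ℝ (fun y : R3 => φ i (y i)) y = _ :=
        fderiv_comp_of_isLocalDiffeomorphAt (g := fun y : R3 => y i) ((hVall y hy).2.2.2.2.1 i)
          (dcoord i).differentiableAt
      have hne := ((hVall y hy).2.2.2.2.1 i).deriv_ne_zero
      rw [h3]
      refine ⟨smul_ne_zero hne h1, ?_⟩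
      rw [h2]
      exact (LinearMap.ker_smul _ _ hne).symm
    · change x y i = _
      rw [hxV hy]
  have hinf : IsFirstIntegralOn (hirotaWeb l f OnePoint.infty) (fun y => g (Φ y)) V := by
    have h0 := isFirstIntegralOn_iff_fderiv.1 ((isFirstIntegralOn_infty_hirotaWeb hf).mono hVU)
    have hgs : ∀ y ∈ V, ContDiffAt ℝ ∞ (fun y => g (Φ y)) y := by
      intro y hy
      obtain ⟨-, hyx, hy0, -, hyφ, -⟩ := hVall y hy
      have hΦy := isLocalDiffeomorphAt_prod hyφ
      exact (hg.contDiffAt (hV₀.mem_nhds hy0)).comp y (contMDiffAt_iff_contDiffAt.1 hΦy.contMDiffAt)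
    refine isFirstIntegralOn_iff_fderiv.2 ⟨fun y hy => (hgs y hy).contDiffWithinAt,
      fun y hy => ?_⟩
    obtain ⟨-, -, -, hyψ, -, hyf⟩ := hVall y hy
    obtain ⟨h1, h2⟩ := h0.2 y hy
    have h3 : fderiv ℝ f y = deriv ψ (g (Φ y)) • fderiv ℝ (fun y => g (Φ y)) y := by
      rw [← fderiv_comp_of_isLocalDiffeomorphAt (g := fun y => g (Φ y)) hyψ
        ((hgs y hy).differentiableAt (by simp))]
      exact Filter.EventuallyEq.fderiv_eq hyf
    refine ⟨fun h => h1 (by rw [h3, h, smul_zero]), ?_⟩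
    rw [h2, h3]
    exact LinearMap.ker_smul _ _ hyψ.deriv_ne_zero
  obtain ⟨hsol, hweb⟩ := isHirotaSolutionOn_of_isVeroneseWebOn hl
    (isVeroneseWebOn_hirotaWeb hl hU hf) hx hV hVx hVU hcoord hinf
  have hVo : IsOpen (x '' V) := x.isOpen_image_of_subset_source hV hVx
  have hgeq : Set.EqOn g ((fun y => g (Φ y)) ∘ x.symm) (x '' V) := by
    rintro _ ⟨y, hy, rfl⟩
    rw [Function.comp_apply, x.left_inv (hVx hy), hxV hy]
  refine ⟨x, hx, hpx, by rw [hxV hpV, hΦp], V, hV, hpV, hVx, hsol.congr hVo hgeq, fun y hy s => ?_⟩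
  rw [hweb y hy s, hirotaWeb_congr (hgeq.eventuallyEq_of_mem (hVo.mem_nhds ⟨y, hy, rfl⟩))]

end Hirota

/-! ### The correspondence -/

section Correspondence

theorem PointedWeb.equiv_refl (W : PointedWeb) : W.Equiv W := by
  refine ⟨id, (Diffeomorph.refl (𝓡 3) W.M ∞).isLocalDiffeomorph W.point, rfl,
    Filter.Eventually.of_forall fun x s => ?_⟩
  rw [mfderiv_id]
  rfl

theorem PointedWeb.Equiv.symm {W W' : PointedWeb} (h : W.Equiv W') : W'.Equiv W := by
  obtain ⟨Φ, hΦ, hp, hev⟩ := h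
  set Ψ := hΦ.localInverse with hΨ
  have hΨp : Ψ W'.point = W.point := by
    rw [← hp]
    exact hΦ.localInverse_left_inv hΦ.localInverse_mem_target
  have hΨd : IsLocalDiffeomorphAt (𝓡 3) (𝓡 3) ∞ Ψ W'.point := by
    rw [← hp]
    exact hΦ.localInverse_isLocalDiffeomorphAt
  refine ⟨Ψ, hΨd, hΨp, ?_⟩
  have hΨc : Filter.Tendsto Ψ (𝓝 W'.point) (𝓝 W.point) := by
    have := hΨd.contMDiffAt.continuousAt.tendsto
    rwa [hΨp] at this
  have hsrc : ∀ᶠ y in 𝓝 W'.point, y ∈ Ψ.source :=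
    Ψ.open_source.mem_nhds (by rw [← hp]; exact hΦ.localInverse_mem_source)
  filter_upwards [hΨc.eventually hev, hΨc.eventually hΦ.eventually, hΨd.eventually, hsrc]
    with y hy hyΦ hyΨ hys s
  have hΦΨ : Φ (Ψ y) = y := hΦ.localInverse_right_inv hys
  have hcomp : (mfderiv (𝓡 3) (𝓡 3) Φ (Ψ y)).comp (mfderiv (𝓡 3) (𝓡 3) Ψ y) =
      ContinuousLinearMap.id ℝ R3 := by
    have h1 := mfderiv_comp y (hyΦ.mdifferentiableAt (by simp)) (hyΨ.mdifferentiableAt (by simp))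
    have h2 : Φ ∘ Ψ =ᶠ[𝓝 y] id := by
      filter_upwards [Ψ.open_source.mem_nhds hys] with z hz
      exact hΦ.localInverse_right_inv hz
    have h3 := h2.mfderiv_eq (I := 𝓡 3) (I' := 𝓡 3)
    rw [mfderiv_id] at h3
    exact h1.symm.trans h3
  ext v
  rw [Submodule.mem_comap, hy s, Submodule.mem_comap]
  refine (mem_tangentField_congr (W'.tangent s) hΦΨ v).symm.trans ?_
  have h4 := DFunLike.congr_fun hcomp v
  exact Iff.of_eq (congrArg (fun w : R3 => (show TangentSpace (𝓡 3) (Φ (Ψ y)) from w) ∈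
    W'.tangent s (Φ (Ψ y))) h4.symm)

theorem PointedWeb.Equiv.trans {W W' W'' : PointedWeb} (h : W.Equiv W') (h' : W'.Equiv W'') :
    W.Equiv W'' := by
  obtain ⟨Φ, hΦ, hp, hev⟩ := h
  obtain ⟨Φ', hΦ', hp', hev'⟩ := h'
  have hΦp : IsLocalDiffeomorphAt (𝓡 3) (𝓡 3) ∞ Φ' (Φ W.point) := by rwa [hp]
  refine ⟨Φ' ∘ Φ, hΦ.comp (𝓡 3) W''.M hΦp, by rw [Function.comp_apply, hp, hp'], ?_⟩
  have hc : Filter.Tendsto Φ (𝓝 W.point) (𝓝 W'.point) := by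
    have := hΦ.contMDiffAt.continuousAt.tendsto
    rwa [hp] at this
  filter_upwards [hev, hc.eventually hev', hΦ.eventually, hc.eventually hΦ'.eventually]
    with x hx hx' hxΦ hxΦ' s
  rw [hx, hx', mfderiv_comp x (hxΦ'.mdifferentiableAt (by simp)) (hxΦ.mdifferentiableAt (by simp))]
  rfl

theorem PointedWeb.equivalence_equiv : Equivalence PointedWeb.Equiv :=
  ⟨PointedWeb.equiv_refl, PointedWeb.Equiv.symm, PointedWeb.Equiv.trans⟩

variable {l : Fin 3 → ℝ}

/-- The pointed Veronese web of a pointed solution. -/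
def PointedSolution.web (hl : Function.Injective l) (S : PointedSolution l) : PointedWeb where
  M := R3
  domain := S.domain
  isOpen_domain := S.isOpen_domain
  point := S.point
  point_mem := S.point_mem
  tangent := hirotaWeb l S.toFun
  isWeb := isVeroneseWebOn_hirotaWeb hl S.isOpen_domain S.isSolution

/-- The four foliations prescribed by a representation determine the whole web, so its coordinates
identify all `F_s`. Conversely, an equivalence pulls back the first integrals `xᵢ` and `f`. -/
theorem PointedWeb.representedBy_iff (hl : Function.Injective l) (W : PointedWeb)
    (S : PointedSolution l) : W.RepresentedBy S ↔ W.Equiv (S.web hl) := by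
  constructor
  · rintro ⟨x, hx, hpx, hxp, V, hV, hpV, hVx, hcoord, hf⟩
    have hsub : V ∩ W.domain ⊆ V := Set.inter_subset_left
    have hVo : IsOpen (V ∩ W.domain) := hV.inter W.isOpen_domain
    obtain ⟨-, hweb⟩ := isHirotaSolutionOn_of_isVeroneseWebOn hl W.isWeb hx hVo
      (hsub.trans hVx) Set.inter_subset_right (fun i => (hcoord i).mono hsub) (hf.mono hsub)
    refine ⟨x, isLocalDiffeomorphAt_of_mem_maximalAtlas hx hpx, hxp, ?_⟩
    filter_upwards [hVo.mem_nhds ⟨hpV, W.point_mem⟩] with q hq s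
    have heq : (fun q => S.toFun (x q)) ∘ x.symm =ᶠ[𝓝 (x q)] S.toFun := by
      filter_upwards [x.open_target.mem_nhds (x.map_source (hVx hq.1))] with z hz
      rw [Function.comp_apply, x.right_inv hz]
    rw [hweb q hq s, hirotaWeb_congr heq]
    rfl
  · rintro ⟨Φ, hΦ, hp, hev⟩
    obtain ⟨x, hx, hpx, hxΦ⟩ := exists_chart_of_isLocalDiffeomorphAt hΦ
    have hdom : ∀ᶠ q in 𝓝 W.point, Φ q ∈ S.domain :=
      hΦ.contMDiffAt.continuousAt.eventually_mem
        (S.isOpen_domain.mem_nhds (by rw [hp]; exact S.point_mem))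
    obtain ⟨V, hVall, hV, hpV⟩ := eventually_nhds_iff.1
      (hev.and (hdom.and (hΦ.eventually.and (x.open_source.mem_nhds hpx))))
    have hVx : V ⊆ x.source := fun q hq => (hVall q hq).2.2.2
    have hxV : Set.EqOn x Φ V := fun q hq => (hxΦ (hVx hq)).symm
    have hpull : ∀ (s : OnePoint ℝ), ∀ q ∈ V, IsLocalDiffeomorphAt (𝓡 3) (𝓡 3) ∞ Φ q ∧
        Φ q ∈ S.domain ∧ W.tangent s q = (hirotaWeb l S.toFun s (Φ q)).comap
          (mfderiv (𝓡 3) (𝓡 3) Φ q).toLinearMap := fun s q hq =>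
      ⟨(hVall q hq).2.2.1, (hVall q hq).2.1, (hVall q hq).1 s⟩
    refine ⟨x, hx, hpx, ?_, V, hV, hpV, hVx, fun i => ?_, ?_⟩
    · rw [hxV hpV]; exact hp
    · refine ((isFirstIntegralOn_coord_hirotaWeb hl S.isSolution.pd_ne_zero
        i).comp_isLocalDiffeomorphAt S.isOpen_domain (hpull (l i))).congr hV fun q hq => ?_
      exact congrArg (fun z : R3 => z i) (hxV hq)
    · refine ((isFirstIntegralOn_infty_hirotaWeb S.isSolution).comp_isLocalDiffeomorphAt
        S.isOpen_domain (hpull _)).congr hV fun q hq => ?_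
      change S.toFun (x q) = S.toFun (Φ q)
      rw [hxV hq]

/-- Two pointed solutions are equivalent if and only if their webs are locally equivalent. -/
theorem PointedSolution.equiv_iff (hl : Function.Injective l) (S T : PointedSolution l) :
    S.Equiv T ↔ (S.web hl).Equiv (T.web hl) := by
  constructor
  · intro h
    obtain ⟨x, hx, hpx, hxp, V, hV, hpV, hVx, -, hweb⟩ := FunEquivAt.exists_chart hl h
      S.isOpen_domain S.point_mem S.isSolution T.isOpen_domain T.point_mem T.isSolution.smooth
    refine ⟨x, isLocalDiffeomorphAt_of_mem_maximalAtlas hx hpx, hxp, ?_⟩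
    filter_upwards [hV.mem_nhds hpV] with q hq s
    exact hweb q hq s
  · rintro ⟨Φ, hΦ, hp, hev⟩
    change R3 → R3 at Φ
    have hp' : Φ S.point = T.point := hp
    have hdom : ∀ᶠ q in 𝓝 S.point, Φ q ∈ T.domain :=
      hΦ.contMDiffAt.continuousAt.eventually_mem
        (T.isOpen_domain.mem_nhds (by rw [hp]; exact T.point_mem))
    obtain ⟨V, hVall, hV, hpV⟩ := eventually_nhds_iff.1
      (hev.and (hdom.and (hΦ.eventually.and (S.isOpen_domain.mem_nhds S.point_mem))))
    change Set R3 at V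
    have hVS : V ⊆ S.domain := fun q hq => (hVall q hq).2.2.2
    have hpull : ∀ (s : OnePoint ℝ) (q : R3), q ∈ V → IsLocalDiffeomorphAt (𝓡 3) (𝓡 3) ∞ Φ q ∧
        Φ q ∈ T.domain ∧ hirotaWeb l S.toFun s q = (hirotaWeb l T.toFun s (Φ q)).comap
          (mfderiv (𝓡 3) (𝓡 3) Φ q).toLinearMap := fun s q hq =>
      ⟨(hVall q hq).2.2.1, (hVall q hq).2.1, (hVall q hq).1 s⟩
    -- The component `i` of `Φ` and the coordinate `i` are first integrals of the same foliation, so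
    -- the former is a function `φ i` of the latter. In the same way `f` is a function `ψ` of `g ∘
    -- Φ`.
    have hφ := fun i => exists_eq_comp_of_isFirstIntegralOn hV
      ((isFirstIntegralOn_coord_hirotaWeb hl T.isSolution.pd_ne_zero
        i).comp_isLocalDiffeomorphAt T.isOpen_domain (hpull (l i)))
      ((isFirstIntegralOn_coord_hirotaWeb hl S.isSolution.pd_ne_zero i).mono hVS) hpV
    choose φ hφd hφe using hφ
    obtain ⟨ψ, hψd, hψe⟩ := exists_eq_comp_of_isFirstIntegralOn hV
      ((isFirstIntegralOn_infty_hirotaWeb S.isSolution).mono hVS)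
      ((isFirstIntegralOn_infty_hirotaWeb T.isSolution).comp_isLocalDiffeomorphAt
        T.isOpen_domain (hpull _)) hpV
    refine ⟨ψ, φ, ?_, fun i => ⟨hφd i, ?_⟩, ?_⟩
    · rw [← hp']; exact hψd
    · rw [← hp']; exact (hφe i).self_of_nhds.symm
    · filter_upwards [hψe, Filter.eventually_all.2 hφe] with y hy hyφ
      rw [hy]
      congr 2
      ext i
      exact hyφ i

/-- Every pointed Veronese web is represented by a solution. -/
theorem PointedWeb.exists_representedBy (hl : Function.Injective l) (W : PointedWeb) :
    ∃ S : PointedSolution l, W.RepresentedBy S := by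
  obtain ⟨x, hx, hpx, hxU, hcoord⟩ := exists_chart_hasCoordinateFoliationsOn hl W.isWeb W.point_mem
  obtain ⟨V', hV', hpV', hVU', f, hf⟩ := W.isWeb.1 OnePoint.infty W.point W.point_mem
  set V := V' ∩ x.source with hVdef
  have hV : IsOpen V := hV'.inter x.open_source
  have hVx : V ⊆ x.source := Set.inter_subset_right
  have hfV := hf.mono (Set.inter_subset_left : V ⊆ V')
  have hcV : HasCoordinateFoliationsOn l W.tangent x V := fun i => (hcoord i).mono hVx
  obtain ⟨hsol, -⟩ := isHirotaSolutionOn_of_isVeroneseWebOn hl W.isWeb hx hV hVx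
    (hVx.trans hxU) hcV hfV
  refine ⟨⟨x '' V, x.isOpen_image_of_subset_source hV hVx, x W.point, ⟨_, ⟨hpV', hpx⟩, rfl⟩,
    f ∘ x.symm, hsol⟩, x, hx, hpx, rfl, V, hV, ⟨hpV', hpx⟩, hVx, hcV, hfV.congr hV fun q hq => ?_⟩
  change f (x.symm (x q)) = f q
  rw [x.left_inv (hVx hq)]

/-- Transported from webs, which avoids inverting and composing the germs `ψ` and `φ i` by hand. -/
theorem PointedSolution.equivalence_equiv (hl : Function.Injective l) :
    Equivalence (PointedSolution.Equiv (l := l)) where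
  refl S := (S.equiv_iff hl S).2 (PointedWeb.equiv_refl _)
  symm h := (PointedSolution.equiv_iff hl _ _).2 ((PointedSolution.equiv_iff hl _ _).1 h).symm
  trans h h' := (PointedSolution.equiv_iff hl _ _).2
    (((PointedSolution.equiv_iff hl _ _).1 h).trans ((PointedSolution.equiv_iff hl _ _).1 h'))

end Correspondence

end

theorem mainTheorem4 (l : Fin 3 → ℝ) (hl : Function.Injective l) :
    -- every solution with nonvanishing first derivatives defines a Veronese web
    (∀ (U : Set R3) (f : R3 → ℝ), IsOpen U → IsHirotaSolutionOn l f U →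
      IsVeroneseWebOn (hirotaWeb l f) U ∧
        HasCoordinateFoliationsOn l (hirotaWeb l f) (fun x => x) U ∧
        IsFirstIntegralOn (hirotaWeb l f OnePoint.infty) f U) ∧
    -- every Veronese web on a smooth 3-manifold arises locally in this way
    (∀ (M : Type*) [TopologicalSpace M] [ChartedSpace R3 M] [IsManifold (𝓡 3) ∞ M]
      (D : OnePoint ℝ → TangentField M), IsVeroneseWebOn D Set.univ → ∀ p : M,
      ∃ x ∈ IsManifold.maximalAtlas (𝓡 3) ∞ M, p ∈ x.source ∧
        HasCoordinateFoliationsOn l D x x.source ∧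
        ∀ (V : Set M) (f : M → ℝ), IsOpen V → V ⊆ x.source →
          IsFirstIntegralOn (D OnePoint.infty) f V →
            IsHirotaSolutionOn l (f ∘ x.symm) (x '' V) ∧
            ∀ q ∈ V, ∀ s : OnePoint ℝ,
              D s q = (hirotaWeb l (f ∘ x.symm) s (x q)).comap
                (mfderiv (𝓡 3) (𝓡 3) x q).toLinearMap) ∧
    -- the equivalence relation on functions preserves solutions
    (∀ (f g : R3 → ℝ) (p q : R3),
      (∃ U : Set R3, IsOpen U ∧ p ∈ U ∧ IsHirotaSolutionOn l f U) →
      (∃ V : Set R3, IsOpen V ∧ q ∈ V ∧ ContDiffOn ℝ ∞ g V) →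
      FunEquivAt f p g q →
      ∃ V : Set R3, IsOpen V ∧ q ∈ V ∧ IsHirotaSolutionOn l g V) ∧
    -- the one-to-one correspondence
    (∃ (hS : Equivalence (PointedSolution.Equiv (l := l))) (hW : Equivalence PointedWeb.Equiv)
      (e : Quotient (Setoid.mk _ hS) ≃ Quotient (Setoid.mk _ hW)),
      ∀ (S : PointedSolution l) (W : PointedWeb),
        e (Quotient.mk (Setoid.mk _ hS) S) = Quotient.mk (Setoid.mk _ hW) W ↔
          W.RepresentedBy S) := by

  refine ⟨fun U f hU h => ⟨isVeroneseWebOn_hirotaWeb hl hU h,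
    isFirstIntegralOn_coord_hirotaWeb hl h.pd_ne_zero, isFirstIntegralOn_infty_hirotaWeb h⟩,
    fun M _ _ _ D hD p => ?_, fun f g p q => ?_, ?_⟩
  · obtain ⟨x, hx, hpx, -, hcoord⟩ := exists_chart_hasCoordinateFoliationsOn hl hD (Set.mem_univ p)
    exact ⟨x, hx, hpx, hcoord, fun V f hV hVx hf => isHirotaSolutionOn_of_isVeroneseWebOn hl hD hx
      hV hVx (Set.subset_univ _) (fun i => (hcoord i).mono hVx) hf⟩
  · rintro ⟨U, hU, hp, hf⟩ ⟨V₀, hV₀, hq, hg⟩ h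
    obtain ⟨x, -, -, hxp, V, hV, hpV, hVx, hsol, -⟩ := h.exists_chart hl hU hp hf hV₀ hq hg
    exact ⟨x '' V, x.isOpen_image_of_subset_source hV hVx, ⟨p, hpV, hxp⟩, hsol⟩
  -- The bijection is induced by `PointedSolution.web`: `PointedSolution.equiv_iff` makes it well
  -- defined and injective, and the existence of straightening coordinates makes it surjective.
  · refine ⟨PointedSolution.equivalence_equiv hl, PointedWeb.equivalence_equiv,
      Equiv.ofBijective (Quotient.map (PointedSolution.web hl)
        fun S T h => (PointedSolution.equiv_iff hl S T).1 h) ⟨?_, ?_⟩, fun S W => ?_⟩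
    · rintro ⟨S⟩ ⟨T⟩ h
      exact Quotient.sound ((PointedSolution.equiv_iff hl S T).2 (Quotient.exact h))
    · rintro ⟨W⟩
      obtain ⟨S, hS⟩ := W.exists_representedBy hl
      exact ⟨Quotient.mk _ S, Quotient.sound ((W.representedBy_iff hl S).1 hS).symm⟩
    · rw [W.representedBy_iff hl S]
      exact ⟨fun h => PointedWeb.Equiv.symm (Quotient.exact h),
        fun h => Quotient.sound (PointedWeb.Equiv.symm h)⟩
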